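/- All systems are finite-dimensional. A (depth-1) finite resource $(\mathcal N:\omega)$ is a quantum operation $\mathcal N:A'\to AB$, with input $A'=A^{\rm rel}A^{\rm abs}$ at Alice and outputs at Alice and Bob, together with a test state $\omega$ of $A^{\rm rel}$; a bipartite state $\rho^{AB}$ is the (static) resource with null input whose operation creates $\rho^{AB}$. A depth-$\ell$ resource is an unordered collection of $\ell$ such components; $R^{\times k}$ consists of $k$ copies of all components, $R^{\otimes k}$ is the componentwise tensor power, and ${\bf S}[R]$ is the tensor product of all components. A protocol ${\bf P}$ on $R$ with created test state $\Omega$ uses each component once, in an order of its choice: Alice applies a first local operation to her input; before each use of a component she applies a local isometry from her laboratory to the input of the component and a memory; at the end Alice and Bob apply local operations. The result is a depth-1 resource ${\bf P}[R]=(\mathcal P:\Omega)$. The protocol is $\varepsilon$-valid if, for every extension $\xi$ of $\Omega$, the state of the test system just before the use of each component $(\mathcal N:\omega)$ is within trace-norm distance $\varepsilon$ of $\omega$. Operations are compared by $\|\mathcal M-\mathcal N\|_\omega=\sup_{\xi\supseteq\omega}\|(\mathrm{id}\otimes\mathcal M)\xi-(\mathrm{id}\otimes\mathcal N)\xi\|_1$,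 the supremum being over all extensions of $\omega$ to the whole input and a reference system. For depth-1 resources, $(\mathcal N:\omega)\stackrel{*}{\ge}(\mathcal N':\omega')$ if $\mathcal N'=(\mathcal D_A\otimes\mathcal D_B)\circ\mathcal N\circ\mathcal E$ for local operations $\mathcal E,\mathcal D_A,\mathcal D_B$ such that $\mathcal E$ maps extensions of $\omega'$ to extensions of $\omega$; for collections, $R\stackrel{*}{\ge}R'$ if the components of $R'$ are so obtained from distinct components of $R$. An asymptotic resource is a sequence $\alpha=(\alpha_n)_n$ of finite resources of constant depth such that $\alpha_n\stackrel{*}{\ge}\alpha_{n-1}$ for all large $n$, and for all $\delta>0$ and integers $k\ge1$, $\alpha_{\lfloor n(1+\delta)\rfloor}\stackrel{*}{\ge}(\alpha_{\lfloor n/k\rfloor})^{\otimes k}\stackrel{*}{\ge}\alpha_{\lfloor n(1-\delta)\rfloor}$ for all large $n$ (a negative index is read as $0$). Write $\langle\rho\rangle=(\rho^{\otimes n})_n$, $z\alpha=(\alpha_{\lfloor zn\rfloor})_n$ for $z\ge0$, and let sums of asymptotic resources be formed by concatenating the collections for each $n$. The inequality $\alpha\ge\beta$ means: for every $\delta>0$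 there is an integer $k\ge1$ such that for every $\varepsilon>0$ and all sufficiently large $n$ there is an $\varepsilon$-valid protocol ${\bf P}$ on $(\alpha_{\lfloor n/k\rfloor})^{\times k}$, creating a resource with the same systems and test state as ${\bf S}[\beta_{\lfloor(1-\delta)n\rfloor}]$, with $$\big\|{\bf P}[(\alpha_{\lfloor n/k\rfloor})^{\times k}]-{\bf S}[\beta_{\lfloor(1-\delta)n\rfloor}]\big\|\le\varepsilon .$$ **Theorem.** Let $(p_x)_x$ be a probability distribution on a finite set, let $\rho_x^{AB}$ be a bipartite state for each $x$, and let $$\sigma^{AX_ABX_B}=\sum_x p_x\,|x\rangle\langle x|^{X_A}\otimes|x\rangle\langle x|^{X_B}\otimes\rho_x^{AB},$$ where Alice holds $AX_A$ and Bob holds $BX_B$. Then $\langle\sigma\rangle$ and $\sum_x p_x\langle\rho_x\rangle$ are asymptotic resources, and $$\langle\sigma\rangle\ \ge\ \sum_x p_x\,\langle\rho_x\rangle .$$ -/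

import Mathlib

open scoped MatrixOrder ComplexOrder

noncomputable section

namespace QRI

/-! ### Systems, states, trace norm -/

/-- A finite-dimensional quantum system with a distinguished orthonormal basis indexed by `carrier`;
its operators are the matrices `Op X = Matrix X X ℂ`.  A null system is a one-dimensional one. -/
structure Sys where
  carrier : Type
  [fin : Fintype carrier]
  [dec : DecidableEq carrier]
  [ne : Nonempty carrier]

instance : CoeSort Sys Type := ⟨Sys.carrier⟩
instance (X : Sys) : Fintype X := X.fin
instance (X : Sys) : DecidableEq X := X.dec
instance (X : Sys) : Nonempty X := X.ne

/-- The null (one-dimensional) system. -/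
abbrev Sys.null : Sys := ⟨Unit⟩

/-- The tensor product `X ⊗ Y`. -/
abbrev Sys.prod (X Y : Sys) : Sys := ⟨X × Y⟩

/-- The tensor product of a finite family of systems. -/
abbrev Sys.pi {ι : Type} [Fintype ι] [DecidableEq ι] (X : ι → Sys) : Sys := ⟨∀ i, X i⟩

/-- Operators on a system. -/
abbrev Op (X : Sys) : Type := Matrix X X ℂ

/-- Trace norm `‖M‖₁ = tr √(M† M)`. -/
def traceNorm {X : Sys} (M : Op X) : ℝ := (CFC.sqrt (M.conjTranspose * M)).trace.re

/-- A state (density operator). -/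
@[ext]
structure State (X : Sys) where
  mat : Op X
  posSemidef : mat.PosSemidef
  trace_eq_one : mat.trace = 1

/-! ### Quantum operations -/

/-- A quantum operation `X → Y`: a linear map with a finite Kraus representation
`M ↦ ∑ c, K c * M * (K c)†`, `∑ c, (K c)† * K c = 1`. -/
@[ext]
structure Channel (X Y : Sys) where
  toLin : Op X →ₗ[ℂ] Op Y
  kraus : ∃ (κ : Type) (_ : Fintype κ) (K : κ → Matrix Y X ℂ),
    ∑ c, (K c).conjTranspose * K c = 1 ∧ ∀ M, toLin M = ∑ c, K c * M * (K c).conjTranspose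

namespace Channel

/-- The action of a quantum operation on states. -/
def onState {X Y : Sys} (N : Channel X Y) (ρ : State X) : State Y where
  mat := N.toLin ρ.mat
  posSemidef := by
    obtain ⟨κ, _, K, -, h⟩ := N.kraus
    rw [h]
    exact Matrix.posSemidef_sum _ fun c _ => ρ.posSemidef.mul_mul_conjTranspose_same (K c)
  trace_eq_one := by
    obtain ⟨κ, _, K, h1, h⟩ := N.kraus
    rw [h, Matrix.trace_sum]
    simp_rw [fun c => Matrix.trace_mul_cycle (K c) ρ.mat (K c).conjTranspose]
    rw [← Matrix.trace_sum, ← Finset.sum_mul, h1, one_mul, ρ.trace_eq_one]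

/-- Composition: `N.comp M` is `M` followed by `N`. -/
def comp {X Y Z : Sys} (N : Channel Y Z) (M : Channel X Y) : Channel X Z where
  toLin := N.toLin ∘ₗ M.toLin
  kraus := by
    obtain ⟨κ, _, K, hK, h⟩ := N.kraus
    obtain ⟨μ, _, L, hL, h'⟩ := M.kraus
    refine ⟨κ × μ, inferInstance, fun c => K c.1 * L c.2, ?_, fun A => ?_⟩
    · rw [Fintype.sum_prod_type_right, ← hL]
      refine Finset.sum_congr rfl fun d _ => ?_
      calc _ = (L d).conjTranspose * (∑ c, (K c).conjTranspose * K c) * L d := by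
              rw [Matrix.mul_sum, Matrix.sum_mul]
              refine Finset.sum_congr rfl fun c _ => ?_
              simp only [Matrix.conjTranspose_mul, Matrix.mul_assoc]
        _ = _ := by rw [hK, Matrix.mul_one]
    · rw [LinearMap.comp_apply, h, h', Fintype.sum_prod_type]
      refine Finset.sum_congr rfl fun c _ => ?_
      rw [Matrix.mul_sum, Matrix.sum_mul]
      refine Finset.sum_congr rfl fun d _ => ?_
      simp only [Matrix.conjTranspose_mul, Matrix.mul_assoc]

/-- The operation `M ↦ V M V†` given by an isometry `V`. -/
def ofIsometry {X Y : Sys} (V : Matrix Y X ℂ) (hV : V.conjTranspose * V = 1) : Channel X Y where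
  toLin :=
    { toFun := fun M => V * M * V.conjTranspose
      map_add' := fun M N => by rw [Matrix.mul_add, Matrix.add_mul]
      map_smul' := fun c M => by simp }
  kraus := ⟨Unit, inferInstance, fun _ => V, by simpa using hV, fun M => by simp⟩

/-- Relabelling of the basis along a bijection (used only to rearrange tensor factors). -/
def relabel {X Y : Sys} (e : X ≃ Y) : Channel X Y where
  toLin :=
    { toFun := fun M => M.submatrix e.symm e.symm
      map_add' := fun _ _ => rfl
      map_smul' := fun _ _ => rfl }
  kraus := by
    refine ⟨Unit, inferInstance, fun _ => Matrix.of fun y x => if y = e x then 1 else 0, ?_, ?_⟩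
    · ext x x'
      simp [Matrix.mul_apply, Matrix.one_apply, e.injective.eq_iff, eq_comm]
    · intro M
      ext y y'
      simp [Matrix.mul_apply, ← Equiv.symm_apply_eq, Finset.sum_ite_eq]
      rfl

/-- The identity operation. -/
def id (X : Sys) : Channel X X := relabel (Equiv.refl _)

/-- Tracing out the second factor. -/
def traceRight (X Y : Sys) : Channel (X.prod Y) X where
  toLin :=
    { toFun := fun M => Matrix.of fun x x' => ∑ y, M (x, y) (x', y)
      map_add' := fun M N => by ext; simp [Finset.sum_add_distrib]
      map_smul' := fun c M => by ext; simp [Finset.mul_sum] }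
  kraus := by
    refine ⟨Y, inferInstance, fun y => Matrix.of fun x z => if z = (x, y) then 1 else 0, ?_, ?_⟩
    · ext ⟨x, y⟩ ⟨x', y'⟩
      rw [Matrix.sum_apply, Matrix.one_apply, Finset.sum_eq_single y]
      · rw [Matrix.mul_apply, Finset.sum_eq_single x]
        · simp [eq_comm]
        · intro b _ hb
          simp [Ne.symm hb]
        · simp
      · intro b _ hb
        simp [Matrix.mul_apply, Ne.symm hb]
      · simp
    · intro M
      ext x x'
      simp [Matrix.mul_apply, Matrix.sum_apply]

/-- Tracing out the first factor. -/
def traceLeft (X Y : Sys) : Channel (X.prod Y) Y :=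
  (traceRight Y X).comp (relabel (Equiv.prodComm X Y))

theorem apply_single {X Y κ : Type} [Fintype X] [DecidableEq X] [Fintype κ]
    (K : κ → Matrix Y X ℂ) (x x' : X) (y y' : Y) :
    (∑ c, K c * Matrix.single x x' (1 : ℂ) * (K c).conjTranspose : Matrix Y Y ℂ) y y'
      = ∑ c, K c y x * star (K c y' x') := by
  rw [Matrix.sum_apply]
  refine Finset.sum_congr rfl fun c _ => ?_
  rw [Matrix.mul_apply, Finset.sum_eq_single x']
  · simp
  · intro b _ hb
    simp [hb]
  · simp

theorem kraus_one_apply {X Y κ : Type} [Fintype Y] [DecidableEq X] [Fintype κ]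
    {K : κ → Matrix Y X ℂ} (h : ∑ c, (K c).conjTranspose * K c = 1) (x x' : X) :
    ∑ c, ∑ y, star (K c y x) * K c y x' = if x = x' then 1 else 0 := by
  rw [← Matrix.one_apply, ← h, Matrix.sum_apply]
  rfl

theorem kraus_apply {X Y κ : Type} [Fintype X] [Fintype κ]
    (K : κ → Matrix Y X ℂ) (M : Matrix X X ℂ) (y y' : Y) :
    (∑ c, K c * M * (K c).conjTranspose : Matrix Y Y ℂ) y y'
      = ∑ x, ∑ x', M x x' * ∑ c, K c y x * star (K c y' x') := by
  simp_rw [Matrix.sum_apply, Matrix.mul_apply, Finset.mul_sum, Finset.sum_mul]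
  rw [Finset.sum_comm_cycle]
  refine Finset.sum_congr rfl fun x _ => ?_
  rw [Finset.sum_comm]
  refine Finset.sum_congr rfl fun x' _ => Finset.sum_congr rfl fun c _ => ?_
  rw [Matrix.conjTranspose_apply]
  ring

/-- The tensor product of two quantum operations: the linear extension of
`|x₁x₂⟩⟨x₁'x₂'| ↦ N(|x₁⟩⟨x₁'|) ⊗ M(|x₂⟩⟨x₂'|)`. -/
def prod {X₁ Y₁ X₂ Y₂ : Sys} (N : Channel X₁ Y₁) (M : Channel X₂ Y₂) :
    Channel (X₁.prod X₂) (Y₁.prod Y₂) where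
  toLin :=
    { toFun := fun R => Matrix.of fun y y' => ∑ x, ∑ x', R x x' *
        (N.toLin (Matrix.single x.1 x'.1 1) y.1 y'.1 * M.toLin (Matrix.single x.2 x'.2 1) y.2 y'.2)
      map_add' := fun R S => by ext; simp [Finset.sum_add_distrib, add_mul]
      map_smul' := fun c R => by ext; simp [Finset.mul_sum, mul_assoc] }
  kraus := by
    obtain ⟨κ, _, K, hK, h⟩ := N.kraus
    obtain ⟨μ, _, L, hL, h'⟩ := M.kraus
    refine ⟨κ × μ, inferInstance, fun c => Matrix.of fun y x => K c.1 y.1 x.1 * L c.2 y.2 x.2,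
      ?_, fun A => ?_⟩
    · ext x x'
      rw [Matrix.one_apply, Matrix.sum_apply]
      calc _ = (∑ c, ∑ y, star (K c y x.1) * K c y x'.1) *
            (∑ d, ∑ y, star (L d y x.2) * L d y x'.2) := by
              simp_rw [Finset.sum_mul_sum, Fintype.sum_prod_type, Matrix.mul_apply]
              refine Finset.sum_congr rfl fun c _ => Finset.sum_congr rfl fun d _ => ?_
              rw [Fintype.sum_prod_type]
              refine Finset.sum_congr rfl fun y _ => Finset.sum_congr rfl fun z _ => ?_
              simp only [Matrix.conjTranspose_apply, Matrix.of_apply, star_mul']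
              ring
        _ = _ := by
              rw [kraus_one_apply hK, kraus_one_apply hL]
              simp only [Prod.ext_iff, ite_and, mul_ite, mul_one, mul_zero]
              split_ifs <;> rfl
    · ext y y'
      rw [kraus_apply]
      refine Finset.sum_congr rfl fun x _ => Finset.sum_congr rfl fun x' _ => ?_
      congr 1
      rw [h, h', apply_single, apply_single, Finset.sum_mul_sum, Fintype.sum_prod_type]
      refine Finset.sum_congr rfl fun c _ => Finset.sum_congr rfl fun d _ => ?_
      simp only [Matrix.of_apply, star_mul']
      ring

/-- The tensor product of a finite family of quantum operations, by linear extension as above. -/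
def pi {ι : Type} [Fintype ι] [DecidableEq ι] {X Y : ι → Sys} (N : ∀ i, Channel (X i) (Y i)) :
    Channel (Sys.pi X) (Sys.pi Y) where
  toLin :=
    { toFun := fun R => Matrix.of fun y y' => ∑ x, ∑ x', R x x' *
        ∏ i, (N i).toLin (Matrix.single (x i) (x' i) 1) (y i) (y' i)
      map_add' := fun R S => by ext; simp [Finset.sum_add_distrib, add_mul]
      map_smul' := fun c R => by ext; simp [Finset.mul_sum, mul_assoc] }
  kraus := by
    choose κ hκ K hK h using fun i => (N i).kraus
    classical
    refine ⟨∀ i, κ i, inferInstance, fun c => Matrix.of fun y x => ∏ i, K i (c i) (y i) (x i),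
      ?_, fun A => ?_⟩
    · ext x x'
      rw [Matrix.one_apply, Matrix.sum_apply]
      calc _ = ∏ i, ∑ c, ∑ y, star (K i c y (x i)) * K i c y (x' i) := by
              rw [Finset.prod_univ_sum, Fintype.piFinset_univ]
              refine Finset.sum_congr rfl fun c _ => ?_
              rw [Finset.prod_univ_sum, Fintype.piFinset_univ, Matrix.mul_apply]
              refine Finset.sum_congr rfl fun y _ => ?_
              simp only [Matrix.conjTranspose_apply, Matrix.of_apply, star_prod,
                Finset.prod_mul_distrib]
        _ = _ := by
              simp_rw [fun i => kraus_one_apply (hK i), Finset.prod_ite_zero, funext_iff]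
              simp
    · ext y y'
      rw [kraus_apply]
      refine Finset.sum_congr rfl fun x _ => Finset.sum_congr rfl fun x' _ => ?_
      congr 1
      rw [Finset.prod_congr rfl fun i _ => (congrFun (congrFun (h i _) (y i)) (y' i)).trans
        (apply_single (K i) (x i) (x' i) (y i) (y' i)), Finset.prod_univ_sum,
        Fintype.piFinset_univ]
      refine Finset.sum_congr rfl fun c _ => ?_
      simp only [Matrix.of_apply, star_prod, Finset.prod_mul_distrib]

/-- Preparation of a state, as an operation without input. -/
def prepare {X : Sys} (ρ : State X) : Channel (Sys.null.prod Sys.null) X where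
  toLin :=
    { toFun := fun M => M ((), ()) ((), ()) • ρ.mat
      map_add' := fun M N => by simp [add_smul]
      map_smul' := fun c M => by simp [mul_smul] }
  kraus := by
    obtain ⟨B, hB⟩ := CStarAlgebra.nonneg_iff_eq_star_mul_self.1
      (Matrix.nonneg_iff_posSemidef.2 ρ.posSemidef)
    rw [Matrix.star_eq_conjTranspose] at hB
    refine ⟨X, inferInstance, fun j => Matrix.of fun x _ => star (B j x), ?_, fun M => ?_⟩
    · ext u v
      have ht := ρ.trace_eq_one
      rw [hB, Matrix.trace] at ht
      rw [Matrix.sum_apply, Matrix.one_apply, if_pos (Subsingleton.elim u v), ← ht,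
        Finset.sum_congr rfl fun j _ => Matrix.mul_apply, Finset.sum_comm]
      simp [Matrix.mul_apply, mul_comm]
    · ext x x'
      rw [kraus_apply, Fintype.sum_eq_single ((), ()) (fun _ h => absurd rfl h),
        Fintype.sum_eq_single ((), ()) (fun _ h => absurd rfl h)]
      simp [hB, Matrix.mul_apply]

end Channel

/-- The product state `⊗ᵢ ρᵢ`. -/
def State.pi {ι : Type} [Fintype ι] [DecidableEq ι] {X : ι → Sys} (ρ : ∀ i, State (X i)) :
    State (Sys.pi X) where
  mat := Matrix.of fun x x' => ∏ i, (ρ i).mat (x i) (x' i)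
  posSemidef := by
    choose B hB using fun i => CStarAlgebra.nonneg_iff_eq_star_mul_self.1
      (Matrix.nonneg_iff_posSemidef.2 (ρ i).posSemidef)
    have h : (Matrix.of fun x x' => ∏ i, (ρ i).mat (x i) (x' i) : Op (Sys.pi X))
        = (Matrix.of fun y x => ∏ i, B i (y i) (x i) : Op (Sys.pi X)).conjTranspose
          * (Matrix.of fun y x => ∏ i, B i (y i) (x i) : Op (Sys.pi X)) := by
      ext x x'
      simp only [hB, Matrix.star_eq_conjTranspose, Matrix.mul_apply, Matrix.of_apply,
        Matrix.conjTranspose_apply]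
      rw [Finset.prod_univ_sum, Fintype.piFinset_univ]
      refine Finset.sum_congr rfl fun y _ => ?_
      simp only [star_prod, Finset.prod_mul_distrib]
    rw [h]
    exact Matrix.posSemidef_conjTranspose_mul_self _
  trace_eq_one := by
    have h : ∏ i, (ρ i).mat.trace = 1 := Finset.prod_eq_one fun i _ => (ρ i).trace_eq_one
    simp only [Matrix.trace] at h
    rw [Finset.prod_univ_sum, Fintype.piFinset_univ] at h
    exact h

/-- The unique state of the null system. -/
def State.null : State Sys.null := ⟨1, Matrix.PosSemidef.one, by simp⟩

/-- The distance `‖M - N‖_ω` of two operations `A₁A₂ → Y` with respect to a state `ω` of `A₁`: the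
supremum of `‖(id ⊗ M) ξ - (id ⊗ N) ξ‖₁` over all reference systems `Q` and all states `ξ` of
`Q A₁ A₂` extending `ω`. -/
def Channel.dist {A₁ A₂ Y : Sys} (M N : Channel (A₁.prod A₂) Y) (ω : State A₁) : ENNReal :=
  ⨆ (Q : Sys) (ξ : State (Q.prod (A₁.prod A₂)))
    (_ : (Channel.traceRight A₁ A₂).onState ((Channel.traceLeft Q _).onState ξ) = ω),
    ENNReal.ofReal (traceNorm
      (((Channel.id Q).prod M).toLin ξ.mat - ((Channel.id Q).prod N).toLin ξ.mat))

/-! ### Finite resources -/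

/-- A finite (depth-1) resource `(N : ω)` between Alice and Bob: an operation
`N : A' → A B` on Alice's input `A' = Arel ⊗ Aabs`, with a test state `ω` of `Arel`. -/
structure FiniteResource where
  Arel : Sys
  Aabs : Sys
  A : Sys
  B : Sys
  N : Channel (Arel.prod Aabs) (A.prod B)
  ω : State Arel

namespace FiniteResource

/-- Alice's input system. -/
abbrev input (R : FiniteResource) : Sys := R.Arel.prod R.Aabs

/-- The static resource given by a bipartite state shared by Alice and Bob: the operation without
input that creates it. -/
abbrev static {A B : Sys} (ρ : State (A.prod B)) : FiniteResource where
  Arel := Sys.null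
  Aabs := Sys.null
  A := A
  B := B
  N := Channel.prepare ρ
  ω := State.null

/-- The tensor product of a finite family of depth-1 resources. -/
abbrev tensor {ι : Type} [Fintype ι] [DecidableEq ι] (R : ι → FiniteResource) : FiniteResource where
  Arel := Sys.pi fun i => (R i).Arel
  Aabs := Sys.pi fun i => (R i).Aabs
  A := Sys.pi fun i => (R i).A
  B := Sys.pi fun i => (R i).B
  N := (Channel.relabel (Equiv.arrowProdEquivProdArrow ι (fun i => (R i).A) fun i => (R i).B)).comp
    ((Channel.pi fun i => (R i).N).comp
      (Channel.relabel
        (Equiv.arrowProdEquivProdArrow ι (fun i => (R i).Arel) fun i => (R i).Aabs).symm))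
  ω := State.pi fun i => (R i).ω

/-- The tensor power `R^{⊗ k}`. -/
abbrev tensorPow (R : FiniteResource) (k : ℕ) : FiniteResource := tensor fun _ : Fin k => R

/-- Reduction `R ≥* R'`: with an encoding by Alice and local decodings by Alice and Bob one has
`N' = D ∘ N ∘ E`, and `E` takes (all extensions of) the test state `ω'` to (extensions of) `ω`. -/
def Reduces (R R' : FiniteResource) : Prop :=
  ∃ (E : Channel R'.input R.input) (DA : Channel R.A R'.A) (DB : Channel R.B R'.B),
    (∀ ξ : State R'.input, (Channel.traceRight _ _).onState ξ = R'.ω →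
      (Channel.traceRight _ _).onState (E.onState ξ) = R.ω) ∧
    R'.N = (DA.prod DB).comp (R.N.comp E)

end FiniteResource

/-- A finite depth-`ℓ` resource: an unordered collection of depth-1 resources, i.e. a family
indexed by a finite type (with `ℓ` elements). -/
structure Resource where
  ι : Type
  [fin : Fintype ι]
  [dec : DecidableEq ι]
  comp : ι → FiniteResource

instance (R : Resource) : Fintype R.ι := R.fin
instance (R : Resource) : DecidableEq R.ι := R.dec

namespace Resource

/-- `R^{× k}`: the collection of `k` copies of all components. -/
abbrev copies (R : Resource) (k : ℕ) : Resource where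
  ι := Fin k × R.ι
  comp := fun i => R.comp i.2

/-- `R^{⊗ k}`: componentwise tensor power. -/
abbrev tensorPow (R : Resource) (k : ℕ) : Resource where
  ι := R.ι
  comp := fun i => (R.comp i).tensorPow k

/-- The standard protocol `S[R]`: the flattening of `R` to a depth-1 resource. -/
abbrev standard (R : Resource) : FiniteResource := FiniteResource.tensor R.comp

/-- Reduction of resources of arbitrary depth. -/
def Reduces (R R' : Resource) : Prop :=
  ∃ f : R'.ι → R.ι, Function.Injective f ∧ ∀ i, (R.comp (f i)).Reduces (R'.comp i)

end Resource

/-! ### Protocols -/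

/-- The joint output system of Bob after the listed components have been used. -/
def bobSys {ι : Type} (R : ι → FiniteResource) : List ι → Sys
  | [] => Sys.null
  | i :: l => (R i).B.prod (bobSys R l)

/-- The rounds of a protocol that uses the listed components of `R` in this order, starting with
Alice's laboratory in system `L` and ending with it in system `L'`.  In each round Alice applies a
local isometry `V` from her laboratory to the input of the next component and a memory `M`, then
the component is applied, and its output on Alice's side together with `M` is her new laboratory. -/
inductive Rounds {ι : Type} (R : ι → FiniteResource) : Sys → List ι → Sys → Type 1
  | done (L : Sys) : Rounds R L [] L
  | round {L M L' : Sys} {i : ι} {l : List ι} (V : Matrix ((R i).input.prod M) L ℂ)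
      (hV : V.conjTranspose * V = 1) (next : Rounds R ((R i).A.prod M) l L') :
      Rounds R L (i :: l) L'

namespace Rounds

variable {ι : Type} {R : ι → FiniteResource}

/-- The overall operation, from Alice's initial laboratory to her final one and all outputs of
Bob. -/
def run {L L' : Sys} {l : List ι} : Rounds R L l L' → Channel L (L'.prod (bobSys R l))
  | .done L => Channel.relabel (Equiv.prodUnique L Unit).symm
  | .round (M := M) (L' := L') (i := i) (l := l) V hV next =>
      (Channel.relabel
        { toFun := fun z => (z.1.1, (z.2, z.1.2))
          invFun := fun z => ((z.1, z.2.2), z.2.1)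
          left_inv := fun _ => rfl
          right_inv := fun _ => rfl } :
        Channel ((L'.prod (bobSys R l)).prod (R i).B) (L'.prod ((R i).B.prod (bobSys R l)))).comp
      ((next.run.prod (Channel.id (R i).B)).comp
      ((Channel.relabel
        { toFun := fun z => ((z.1.1, z.2), z.1.2)
          invFun := fun z => ((z.1.1, z.2), z.1.2)
          left_inv := fun _ => rfl
          right_inv := fun _ => rfl } :
        Channel (((R i).A.prod (R i).B).prod M) (((R i).A.prod M).prod (R i).B)).comp
      (((R i).N.prod (Channel.id M)).comp (Channel.ofIsometry V hV))))

/-- `η`-validity on an initial state of Alice's laboratory: directly before each use of a component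
`(N : ω)`, the restriction of the current state to the test system of that component is `η`-close
to `ω`.  Outputs of Bob are not touched before the end, so they are traced out at once. -/
def Valid (η : ℝ) {L L' : Sys} {l : List ι} : Rounds R L l L' → State L → Prop
  | .done _, _ => True
  | .round (M := M) (i := i) V hV next, τ =>
      let τ' : State ((R i).input.prod M) := (Channel.ofIsometry V hV).onState τ
      traceNorm (((Channel.traceRight (R i).Arel (R i).Aabs).onState
        ((Channel.traceRight (R i).input M).onState τ')).mat - (R i).ω.mat) ≤ η ∧
      next.Valid η ((((Channel.traceRight (R i).A (R i).B).comp (R i).N).prod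
        (Channel.id M)).onState τ')

end Rounds

/-- A protocol consuming the resource `R`, creating a depth-1 resource with Alice's input
`Arel ⊗ Aabs` and outputs `A` and `B`: all components of `R` are put in an order of choice, Alice
applies a first local operation, the rounds are run, and Alice and Bob apply final local
operations. -/
structure Protocol (R : Resource) (Arel Aabs A B : Sys) where
  order : List R.ι
  nodup : order.Nodup
  complete : ∀ i, i ∈ order
  start : Sys
  finish : Sys
  enc : Channel (Arel.prod Aabs) start
  rounds : Rounds R.comp start order finish
  final : Channel finish A
  dec : Channel (bobSys R.comp order) B

namespace Protocol

variable {R : Resource} {Arel Aabs A B : Sys}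

/-- The operation `𝒫` implemented by the protocol. -/
def map (P : Protocol R Arel Aabs A B) : Channel (Arel.prod Aabs) (A.prod B) :=
  (P.final.prod P.dec).comp (P.rounds.run.comp P.enc)

/-- The created resource `P[R] = (𝒫 : Ω)`, for a test state `Ω`. -/
abbrev create (P : Protocol R Arel Aabs A B) (Ω : State Arel) : FiniteResource :=
  ⟨Arel, Aabs, A, B, P.map, Ω⟩

/-- `η`-validity with respect to the test state `Ω` of the created resource: the conditions hold
for all extensions `ξ` of `Ω` (the reference system `Q` is not acted on by the protocol and does
not enter the restricted states). -/
def Valid (P : Protocol R Arel Aabs A B) (η : ℝ) (Ω : State Arel) : Prop :=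
  ∀ (Q : Sys) (ξ : State (Q.prod (Arel.prod Aabs))),
    (Channel.traceRight Arel Aabs).onState ((Channel.traceLeft Q _).onState ξ) = Ω →
      P.rounds.Valid η (P.enc.onState ((Channel.traceLeft Q _).onState ξ))

end Protocol

/-! ### Asymptotic resources -/

/-- A sequence of finite resources of constant depth. -/
structure ResourceSeq where
  ι : Type
  [fin : Fintype ι]
  [dec : DecidableEq ι]
  comp : ℕ → ι → FiniteResource

instance (α : ResourceSeq) : Fintype α.ι := α.fin
instance (α : ResourceSeq) : DecidableEq α.ι := α.dec

namespace ResourceSeq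

/-- The `n`-th member of the sequence. -/
abbrev nth (α : ResourceSeq) (n : ℕ) : Resource where
  ι := α.ι
  comp := α.comp n

/-- The two conditions which make a sequence of finite resources an asymptotic resource. -/
structure IsAsymptotic (α : ResourceSeq) : Prop where
  monotone : ∀ᶠ n in Filter.atTop, (α.nth n).Reduces (α.nth (n - 1))
  quasi_iid : ∀ δ : ℝ, 0 < δ → ∀ k : ℕ, 0 < k → ∀ᶠ n : ℕ in Filter.atTop,
    (α.nth ⌊n * (1 + δ)⌋₊).Reduces ((α.nth (n / k)).tensorPow k) ∧
    ((α.nth (n / k)).tensorPow k).Reduces (α.nth ⌊n * (1 - δ)⌋₊)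

/-- The i.i.d. resource `⟨N : ω⟩`. -/
abbrev iid (R : FiniteResource) : ResourceSeq where
  ι := Unit
  comp := fun n _ => R.tensorPow n

/-- The multiple `z α = (α_{⌊z n⌋})ₙ`. -/
abbrev smul (z : ℝ) (α : ResourceSeq) : ResourceSeq where
  ι := α.ι
  comp := fun n => α.comp ⌊z * n⌋₊

/-- The sum of a finite family of resources, i.e. the concatenation of the collections. -/
abbrev sum {κ : Type} [Fintype κ] [DecidableEq κ] (α : κ → ResourceSeq) : ResourceSeq where
  ι := Σ x, (α x).ι
  comp := fun n i => (α i.1).comp n i.2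

/-- The asymptotic resource inequality `α ≥ β`: for every inefficiency `δ` there is a number `k` of
blocks such that for every accuracy `ε` and all large blocklengths `n` some `ε`-valid protocol
turns `(α_{⌊n/k⌋})^{× k}` into `S[β_{⌊(1-δ)n⌋}]` up to an error `ε`. -/
def Ge (α β : ResourceSeq) : Prop :=
  ∀ δ : ℝ, 0 < δ → ∃ k : ℕ, 0 < k ∧ ∀ ε : ℝ, 0 < ε → ∃ n₀ : ℕ, ∀ n : ℕ, n₀ ≤ n →
    let T : FiniteResource := (β.nth ⌊(1 - δ) * n⌋₊).standard
    ∃ P : Protocol ((α.nth (n / k)).copies k) T.Arel T.Aabs T.A T.B,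
      P.Valid ε T.ω ∧ (P.create T.ω).N.dist T.N T.ω ≤ ENNReal.ofReal ε

end ResourceSeq

/-! ### Ensembles with a shared classical label -/

/-- The state `∑ₓ pₓ |x⟩⟨x|^{X_A} ⊗ |x⟩⟨x|^{X_B} ⊗ ρₓ^{AB}` with Alice holding `A X_A` and Bob
holding `B X_B`. -/
def labelled {X A B : Sys} (p : X → ℝ) (hp : ∀ x, 0 ≤ p x) (hp1 : ∑ x, p x = 1)
    (ρ : X → State (A.prod B)) : State ((A.prod X).prod (B.prod X)) where
  mat := ∑ x, (p x : ℂ) • (Matrix.kronecker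
    (Matrix.kronecker (Matrix.single x x (1 : ℂ)) (Matrix.single x x (1 : ℂ)))
    (ρ x).mat).submatrix (fun z => ((z.1.2, z.2.2), (z.1.1, z.2.1)))
      (fun z => ((z.1.2, z.2.2), (z.1.1, z.2.1)))
  posSemidef := by
    refine Matrix.posSemidef_sum _ fun x _ => Matrix.PosSemidef.smul ?_ ?_
    · have h : (Matrix.single x x (1 : ℂ) : Op X).PosSemidef := by
        have : (Matrix.single x x (1 : ℂ) : Op X)
            = (Matrix.single x x (1 : ℂ)).conjTranspose * Matrix.single x x (1 : ℂ) := by simp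
        rw [this]
        exact Matrix.posSemidef_conjTranspose_mul_self _
      exact ((h.kronecker h).kronecker (ρ x).posSemidef).submatrix _
    · exact_mod_cast hp x
  trace_eq_one := by
    rw [Matrix.trace_sum]
    have h : ∀ M : Op ((X.prod X).prod (A.prod B)),
        (M.submatrix (fun z => ((z.1.2, z.2.2), (z.1.1, z.2.1)))
          (fun z => ((z.1.2, z.2.2), (z.1.1, z.2.1))) :
            Op ((A.prod X).prod (B.prod X))).trace = M.trace := fun M =>
      Fintype.sum_equiv
        { toFun := fun z => ((z.1.2, z.2.2), (z.1.1, z.2.1))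
          invFun := fun z => ((z.2.1, z.1.1), (z.2.2, z.1.2))
          left_inv := fun _ => rfl
          right_inv := fun _ => rfl } _ _ fun _ => rfl
    simp_rw [Matrix.trace_smul]
    rw [Finset.sum_congr rfl fun x _ => congrArg ((p x : ℂ) • ·) (h _)]
    simp only [Matrix.kronecker, Matrix.trace_kronecker, Matrix.trace_single_eq_same,
      (ρ _).trace_eq_one, mul_one, smul_eq_mul]
    exact_mod_cast hp1

end QRI

end

noncomputable section

namespace QRI

/-! ### Trace norm of a difference of positive operators -/

/-! Alice and Bob hold identical copies of the classical label, so both can measure the labels of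
`n` copies of the ensemble and read the same sequence `c` without communicating. The sequence occurs
with probability `∏ i, p (c i)` and leaves the product of the states `ρ (c i)`
(`block_unzip_labelled`). If `c` contains every label often enough, the parties keep the same
positions, fixed in advance as a function of `c`, and discard the rest. What remains is exactly the
target product (`exists_extraction`). For any other `c` they output something arbitrary.

Good sequences contribute no error. The bad ones contribute a difference of two positive operators,
each with trace equal to the probability of a bad sequence, so the trace-norm error is at most twice
that probability (`traceNorm_sub_le`, `Channel.dist_le`, `exists_protocol`). The target asks for
about `(1 - δ) * p x * n` factors with label `x`. A Chernoff bound and a union bound over the labels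
with `p x ≠ 0` make the bad probability exponentially small in `n` (`sum_prod_filter_card_lt_le`,
`sum_prod_filter_not_fill_le`). One block and one round suffice, and validity is automatic because
the test system is one-dimensional.

That both sides are asymptotic resources comes down to counting copies: a product of bipartite
states reduces to any subproduct by local discarding (`Presents.reduces`), so only inequalities
between floors remain. -/

theorem traceNorm_eq_of_sq {X : Sys} {M S : Op X} (hS : S.PosSemidef)
    (h : S * S = M.conjTranspose * M) : traceNorm M = S.trace.re := by
  rw [traceNorm, CFC.sqrt_unique h (Matrix.nonneg_iff_posSemidef.2 hS)]

theorem traceNorm_zero {X : Sys} : traceNorm (0 : Op X) = 0 := by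
  rw [traceNorm_eq_of_sq Matrix.PosSemidef.zero (by simp)]
  simp

/-- The trace norm of a difference of positive operators is at most the sum of their traces. -/
theorem traceNorm_sub_le {X : Sys} {P N : Op X} (hP : P.PosSemidef) (hN : N.PosSemidef) :
    traceNorm (P - N) ≤ (P.trace + N.trace).re := by
  have hH : (P - N).IsHermitian := hP.isHermitian.sub hN.isHermitian
  set U : Op X := (hH.eigenvectorUnitary : Op X) with hU
  have hU1 : U.conjTranspose * U = 1 := (Unitary.mem_iff.1 hH.eigenvectorUnitary.2).1
  have hU2 : U * U.conjTranspose = 1 := (Unitary.mem_iff.1 hH.eigenvectorUnitary.2).2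
  set d := hH.eigenvalues with hd
  have hspec : P - N = U * Matrix.diagonal (fun i => (d i : ℂ)) * U.conjTranspose := by
    have := hH.spectral_theorem
    rw [Unitary.conjStarAlgAut_apply] at this
    exact this
  have hdiag : U.conjTranspose * P * U - U.conjTranspose * N * U
      = Matrix.diagonal (fun i => (d i : ℂ)) := by
    rw [← Matrix.sub_mul, ← Matrix.mul_sub, hspec]
    simp only [Matrix.mul_assoc, hU1, Matrix.mul_one]
    rw [← Matrix.mul_assoc, hU1, Matrix.one_mul]
  -- The absolute value of `P - N`, formed in its eigenbasis.
  have hS : (U * Matrix.diagonal (fun i => ((|d i| : ℝ) : ℂ)) * U.conjTranspose).PosSemidef := by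
    refine Matrix.PosSemidef.mul_mul_conjTranspose_same ?_ U
    exact Matrix.PosSemidef.diagonal fun i => by simp
  rw [traceNorm_eq_of_sq hS]
  · have ht : ∀ M : Op X, (U.conjTranspose * M * U).trace = M.trace := fun M => by
      rw [Matrix.trace_mul_cycle, hU2, Matrix.one_mul]
    rw [Matrix.trace_mul_cycle, hU1, Matrix.one_mul, Matrix.trace_diagonal, ← ht P, ← ht N,
      Matrix.trace, Matrix.trace, ← Finset.sum_add_distrib, Complex.re_sum, Complex.re_sum]
    refine Finset.sum_le_sum fun i _ => ?_
    have h1 := (hP.conjTranspose_mul_mul_same U).diag_nonneg (i := i)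
    have h2 := (hN.conjTranspose_mul_mul_same U).diag_nonneg (i := i)
    have h3 := congrArg Complex.re (congrFun (congrFun hdiag i) i)
    simp only [Matrix.sub_apply, Matrix.diagonal_apply_eq, Complex.sub_re,
      Complex.ofReal_re] at h3
    have h1' := (Complex.le_def.1 h1).1
    have h2' := (Complex.le_def.1 h2).1
    simp only [Complex.zero_re] at h1' h2'
    simp only [Matrix.diag_apply, Complex.add_re, Complex.ofReal_re, ← h3]
    -- Each eigenvalue is a difference of nonnegative diagonal entries of the conjugated `P` and
    -- `N`, so its absolute value is at most their sum.
    rw [abs_le]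
    constructor <;> linarith
  · rw [hH.eq, hspec]
    have : ∀ D : Op X, U * D * U.conjTranspose * (U * D * U.conjTranspose)
        = U * (D * D) * U.conjTranspose := fun D => by
      calc _ = U * D * (U.conjTranspose * U) * D * U.conjTranspose := by
            simp only [Matrix.mul_assoc]
        _ = _ := by rw [hU1]; simp only [Matrix.mul_assoc, Matrix.mul_one]
    rw [this, this, Matrix.diagonal_mul_diagonal, Matrix.diagonal_mul_diagonal]
    congr 3
    ext i
    rw [← Complex.ofReal_mul, ← Complex.ofReal_mul, abs_mul_abs_self]

/-! ### Calculus of quantum operations -/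

/-- The tensor product of operators. -/
def kron {X Y : Sys} (M : Op X) (N : Op Y) : Op (X.prod Y) :=
  Matrix.of fun z z' => M z.1 z'.1 * N z.2 z'.2

theorem kron_apply {X Y : Sys} (M : Op X) (N : Op Y) (z z' : X.prod Y) :
    kron M N z z' = M z.1 z'.1 * N z.2 z'.2 := rfl

theorem kron_single {X Y : Sys} (i j : X) (i' j' : Y) (r : ℂ) :
    kron (Matrix.single i j r) (Matrix.single i' j' 1) = Matrix.single (i, i') (j, j') r :=
  (Matrix.single_kronecker_single i j i' j' r 1).trans (by rw [mul_one])

namespace Channel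

theorem toLin_apply {X Y : Sys} (N : Channel X Y) (M : Op X) (y y' : Y) :
    N.toLin M y y' = ∑ x, ∑ x', M x x' * N.toLin (Matrix.single x x' 1) y y' := by
  conv_lhs => rw [Matrix.matrix_eq_sum_single M]
  simp only [map_sum, Matrix.sum_apply]
  refine Finset.sum_congr rfl fun x _ => Finset.sum_congr rfl fun x' _ => ?_
  have : Matrix.single x x' (M x x') = M x x' • Matrix.single x x' (1 : ℂ) := by simp
  rw [this, map_smul, Matrix.smul_apply, smul_eq_mul]

/-- Bilinearity carries the definition on matrix units over to all product operators. Together with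
`lin_ext_kron` it reduces identities between tensor products of operations to their factors. -/
theorem prod_kron {X₁ Y₁ X₂ Y₂ : Sys} (N : Channel X₁ Y₁) (M : Channel X₂ Y₂) (R : Op X₁)
    (S : Op X₂) : (N.prod M).toLin (kron R S) = kron (N.toLin R) (M.toLin S) := by
  ext ⟨y, z⟩ ⟨y', z'⟩
  rw [kron_apply, toLin_apply N, toLin_apply M]
  change ∑ x : X₁ × X₂, ∑ x' : X₁ × X₂, _ = _
  simp_rw [Finset.sum_mul_sum]
  rw [Fintype.sum_prod_type]
  refine Finset.sum_congr rfl fun x _ => Finset.sum_congr rfl fun x₂ _ => ?_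
  rw [Fintype.sum_prod_type]
  refine Finset.sum_congr rfl fun x' _ => Finset.sum_congr rfl fun x₂' _ => ?_
  rw [kron_apply]
  ring

/-- Linear maps that agree on product operators are equal. -/
theorem lin_ext_kron {X Y Z : Sys} {f g : Op (X.prod Y) →ₗ[ℂ] Op Z}
    (h : ∀ R S, f (kron R S) = g (kron R S)) : f = g := by
  refine LinearMap.ext fun M => ?_
  refine Matrix.induction_on M (fun p q hp hq => by rw [map_add, map_add, hp, hq]) ?_
  rintro ⟨i, i'⟩ ⟨j, j'⟩ r
  exact kron_single i j i' j' r ▸ h _ _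

theorem ext_kron {X Y Z : Sys} {N M : Channel (X.prod Y) Z}
    (h : ∀ R S, N.toLin (kron R S) = M.toLin (kron R S)) : N = M :=
  Channel.ext (lin_ext_kron h)

theorem comp_toLin {X Y Z : Sys} (N : Channel Y Z) (M : Channel X Y) (R : Op X) :
    (N.comp M).toLin R = N.toLin (M.toLin R) := rfl

theorem relabel_toLin {X Y : Sys} (e : X ≃ Y) (R : Op X) :
    (relabel e).toLin R = R.submatrix e.symm e.symm := rfl

theorem id_toLin {X : Sys} (R : Op X) : (id X).toLin R = R := rfl

theorem prod_comp {X₁ Y₁ Z₁ X₂ Y₂ Z₂ : Sys} (N : Channel Y₁ Z₁) (N' : Channel X₁ Y₁)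
    (M : Channel Y₂ Z₂) (M' : Channel X₂ Y₂) :
    (N.comp N').prod (M.comp M') = (N.prod M).comp (N'.prod M') := by
  refine ext_kron fun R S => ?_
  rw [comp_toLin, prod_kron, prod_kron, prod_kron]
  rfl

theorem prod_relabel {X₁ Y₁ X₂ Y₂ : Sys} (e : X₁ ≃ Y₁) (f : X₂ ≃ Y₂) :
    (relabel e).prod (relabel f) = (relabel (e.prodCongr f) : Channel (X₁.prod X₂) (Y₁.prod Y₂)) := by
  refine ext_kron fun R S => ?_
  rw [prod_kron]
  rfl

/-- Splitting the system along `e` and discarding the second part. -/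
def ptrace {X Y E : Sys} (e : X ≃ Y × E) : Channel X Y :=
  (traceRight Y E).comp (relabel (Y := Y.prod E) e)

/-- Two local partial traces amount to one joint partial trace after regrouping the four factors. -/
theorem traceRight_prod_apply {Y₁ E₁ Y₂ E₂ : Sys} (M : Op ((Y₁.prod E₁).prod (Y₂.prod E₂)))
    (y y' : Y₁.prod Y₂) :
    ((traceRight Y₁ E₁).prod (traceRight Y₂ E₂)).toLin M y y'
      = ∑ w : E₁ × E₂, M ((y.1, w.1), (y.2, w.2)) ((y'.1, w.1), (y'.2, w.2)) := by
  have : (traceRight Y₁ E₁).prod (traceRight Y₂ E₂) = (traceRight (Y₁.prod Y₂) (E₁.prod E₂)).comp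
      (relabel (X := (Y₁.prod E₁).prod (Y₂.prod E₂)) (Y := (Y₁.prod Y₂).prod (E₁.prod E₂))
        (Equiv.prodProdProdComm Y₁ E₁ Y₂ E₂)) := by
    refine ext_kron fun R S => ?_
    rw [prod_kron]
    ext ⟨y, z⟩ ⟨y', z'⟩
    change (∑ w, R (y, w) (y', w)) * (∑ w, S (z, w) (z', w))
      = ∑ w : E₁ × E₂, R (y, w.1) (y', w.1) * S (z, w.2) (z', w.2)
    rw [Finset.sum_mul_sum, Fintype.sum_prod_type]
  rw [this]
  rfl

theorem ptrace_prod_apply {X₁ Y₁ E₁ X₂ Y₂ E₂ : Sys} (e : X₁ ≃ Y₁ × E₁) (f : X₂ ≃ Y₂ × E₂)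
    (M : Op (X₁.prod X₂)) (y y' : Y₁.prod Y₂) :
    ((ptrace e).prod (ptrace f)).toLin M y y'
      = ∑ w : E₁ × E₂, M (e.symm (y.1, w.1), f.symm (y.2, w.2))
          (e.symm (y'.1, w.1), f.symm (y'.2, w.2)) := by
  rw [ptrace, ptrace, prod_comp, comp_toLin, prod_relabel, traceRight_prod_apply]
  rfl

/-- The operation controlled by a classical label in the second factor, which is measured. -/
def control {X C Y : Sys} (D : C → Channel X Y) : Channel (X.prod C) Y where
  toLin :=
    { toFun := fun M => ∑ c, (D c).toLin (M.submatrix (fun x => (x, c)) (fun x => (x, c)))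
      map_add' := fun M N => by simp [Matrix.submatrix_add, Finset.sum_add_distrib]
      map_smul' := fun r M => by simp [Matrix.submatrix_smul, Finset.smul_sum] }
  kraus := by
    choose κ hκ K hK h using fun c => (D c).kraus
    -- The Kraus operators are those of `D c` tensored with the bra `⟨c|` on the label.
    refine ⟨Σ c, κ c, inferInstance, fun i => Matrix.of fun y z =>
      if z.2 = i.1 then K i.1 i.2 y z.1 else 0, ?_, fun M => ?_⟩
    · ext ⟨x, c⟩ ⟨x', c'⟩
      rw [Matrix.sum_apply, Fintype.sum_sigma, Fintype.sum_eq_single c]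
      · by_cases hc : c' = c
        · subst hc
          have := congrFun (congrFun (hK c') x) x'
          rw [Matrix.sum_apply] at this
          simp only [Matrix.mul_apply, Matrix.conjTranspose_apply, Matrix.of_apply, if_true,
            Matrix.one_apply, Prod.mk.injEq, and_true] at this ⊢
          exact this
        · simp [Matrix.mul_apply, hc, Ne.symm hc]
      · intro b hb
        simp [Matrix.mul_apply, Ne.symm hb]
    · ext y y'
      rw [Fintype.sum_sigma]
      simp only [LinearMap.coe_mk, AddHom.coe_mk, h, Matrix.sum_apply]
      refine Finset.sum_congr rfl fun c _ => Finset.sum_congr rfl fun k _ => ?_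
      simp only [Matrix.mul_apply, Matrix.conjTranspose_apply, Matrix.of_apply,
        Matrix.submatrix_apply, Fintype.sum_prod_type]
      simp only [ite_mul, zero_mul, Finset.sum_ite_eq', Finset.mem_univ, if_true,
        apply_ite star, star_zero, mul_ite, mul_zero]

/-- The blocks of two classical labels. -/
def block {X₁ C₁ X₂ C₂ : Sys} (M : Op ((X₁.prod C₁).prod (X₂.prod C₂))) (c : C₁) (c' : C₂) :
    Op (X₁.prod X₂) :=
  M.submatrix (fun z => ((z.1, c), (z.2, c'))) (fun z => ((z.1, c), (z.2, c')))

/-- Each party measures its label, so only blocks diagonal in both labels survive. Both sides are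
linear, hence product operators suffice as a test. -/
theorem control_prod_toLin {X₁ C₁ Y₁ X₂ C₂ Y₂ : Sys} (D : C₁ → Channel X₁ Y₁)
    (D' : C₂ → Channel X₂ Y₂) (M : Op ((X₁.prod C₁).prod (X₂.prod C₂))) :
    ((control D).prod (control D')).toLin M
      = ∑ c, ∑ c', ((D c).prod (D' c')).toLin (block M c c') := by
  let g : Op ((X₁.prod C₁).prod (X₂.prod C₂)) →ₗ[ℂ] Op (Y₁.prod Y₂) :=
    { toFun := fun M => ∑ c, ∑ c', ((D c).prod (D' c')).toLin (block M c c')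
      map_add' := fun M N => by
        have : ∀ c c', block (M + N) c c' = block M c c' + block N c c' := fun _ _ => rfl
        simp only [this, map_add, Finset.sum_add_distrib]
      map_smul' := fun r M => by
        have : ∀ c c', block (r • M) c c' = r • block M c c' := fun _ _ => rfl
        simp only [this, map_smul, Finset.smul_sum, RingHom.id_apply] }
  have : ((control D).prod (control D')).toLin = g := by
    refine lin_ext_kron fun R S => ?_
    rw [prod_kron]
    change kron (∑ c, (D c).toLin (R.submatrix (fun x => (x, c)) (fun x => (x, c))))
      (∑ c, (D' c).toLin (S.submatrix (fun x => (x, c)) (fun x => (x, c))))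
      = ∑ c, ∑ c', ((D c).prod (D' c')).toLin (kron (R.submatrix (fun x => (x, c)) (fun x => (x, c)))
         (S.submatrix (fun x => (x, c')) (fun x => (x, c'))))
    simp only [prod_kron]
    ext ⟨y, z⟩ ⟨y', z'⟩
    simp only [Matrix.sum_apply, kron_apply, Finset.sum_mul_sum]
  rw [this]
  rfl

/-- Discarding everything and preparing a basis state. -/
def reset {X Y : Sys} (y₀ : Y) : Channel X Y :=
  (relabel (X := Y.prod Sys.null) (Equiv.prodUnique Y Unit)).comp <|
    (traceRight (Y.prod Sys.null) X).comp <|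
      ofIsometry (Matrix.of fun z x => if z = ((y₀, ()), x) then 1 else 0) (by
        ext x x'
        simp [Matrix.mul_apply, Matrix.one_apply, eq_comm])

end Channel

/-! ### Operations without input -/

/-- Every operator on a one-dimensional system is a multiple of `1`, so an operation without input
is determined by the state it prepares. -/
theorem Channel.ext_one {X Y : Sys} [Subsingleton X] {N M : Channel X Y}
    (h : N.toLin 1 = M.toLin 1) : N = M := by
  refine Channel.ext (LinearMap.ext fun R => ?_)
  obtain ⟨x⟩ := X.ne
  have : R = R x x • (1 : Op X) := by
    ext i j
    rw [Subsingleton.elim i x, Subsingleton.elim j x]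
    simp
  rw [this, map_smul, map_smul, h]

/-- Normalisation fixes the only matrix entry. All conditions on test states of static resources
hold for this reason. -/
instance State.subsingleton {X : Sys} [Subsingleton X] : Subsingleton (State X) where
  allEq ρ τ := by
    have h := ρ.trace_eq_one.trans τ.trace_eq_one.symm
    ext i j
    rw [Matrix.trace, Matrix.trace, Fintype.sum_subsingleton _ i, Fintype.sum_subsingleton _ i] at h
    rw [Subsingleton.elim j i]
    exact h

theorem relabel_one {X Y : Sys} (e : X ≃ Y) : (Channel.relabel e).toLin 1 = 1 :=
  Matrix.submatrix_one_equiv e.symm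

/-- On a one-dimensional input, the effect of an operation with a reference system. -/
theorem Channel.id_prod_toLin {Q X Y : Sys} [Subsingleton X] (N : Channel X Y)
    (ξ : Op (Q.prod X)) :
    ((Channel.id Q).prod N).toLin ξ = kron ((Channel.traceRight Q X).toLin ξ) (N.toLin 1) := by
  have : ξ = kron ((Channel.traceRight Q X).toLin ξ) 1 := by
    ext ⟨q, a⟩ ⟨q', a'⟩
    rw [kron_apply, Subsingleton.elim a' a, Matrix.one_apply_eq, mul_one]
    change _ = ∑ y, ξ (q, y) (q', y)
    rw [Fintype.sum_subsingleton _ a]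
  conv_lhs => rw [this]
  rw [Channel.prod_kron, Channel.id_toLin]

theorem kron_posSemidef {X Y : Sys} {M : Op X} {N : Op Y} (hM : M.PosSemidef)
    (hN : N.PosSemidef) : (kron M N).PosSemidef := hM.kronecker hN

theorem trace_kron {X Y : Sys} (M : Op X) (N : Op Y) :
    (kron M N).trace = M.trace * N.trace := Matrix.trace_kronecker M N

/-- The distance of two operations without input, whose outputs differ by a difference of positive
operators of small trace. -/
theorem Channel.dist_le {A₁ A₂ Y : Sys} [Subsingleton A₁] [Subsingleton A₂]
    (M N : Channel (A₁.prod A₂) Y) (ω : State A₁) {P P' : Op Y} (hP : P.PosSemidef)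
    (hP' : P'.PosSemidef) (h : M.toLin 1 - N.toLin 1 = P - P') {ε : ℝ}
    (hε : (P.trace + P'.trace).re ≤ ε) : M.dist N ω ≤ ENNReal.ofReal ε := by
  refine iSup_le fun Q => iSup_le fun ξ => iSup_le fun _ => ENNReal.ofReal_le_ofReal ?_
  rw [Channel.id_prod_toLin, Channel.id_prod_toLin]
  set τ := (Channel.traceRight Q (A₁.prod A₂)).onState ξ
  -- The reference system carries a normalised state `τ` in product with the output, so tensoring
  -- with it preserves positivity and traces.
  have hk : kron τ.mat (M.toLin 1) - kron τ.mat (N.toLin 1) = kron τ.mat P - kron τ.mat P' := by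
    ext z z'
    have := congrFun (congrFun h z.2) z'.2
    simp only [Matrix.sub_apply, kron_apply] at this ⊢
    rw [← mul_sub, this, mul_sub]
  change traceNorm (kron τ.mat (M.toLin 1) - kron τ.mat (N.toLin 1)) ≤ ε
  rw [hk]
  refine (traceNorm_sub_le (kron_posSemidef τ.posSemidef hP)
    (kron_posSemidef τ.posSemidef hP')).trans ?_
  rwa [trace_kron, trace_kron, τ.trace_eq_one, one_mul, one_mul]

/-! ### Products of bipartite states -/

section Families

variable {ι κ : Type} [Fintype ι] [DecidableEq ι] [Fintype κ] [DecidableEq κ] {A B : Sys}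

/-- The product of a family of bipartite states, split between Alice and Bob. -/
def prodOp (ρ : ι → State (A.prod B)) :
    Op ((Sys.pi fun _ : ι => A).prod (Sys.pi fun _ : ι => B)) :=
  Matrix.of fun z z' => ∏ i, (ρ i).mat (z.1 i, z.2 i) (z'.1 i, z'.2 i)

/-- A static resource that consists of the product of a family of bipartite states. -/
structure Presents (R : FiniteResource) (ρ : ι → State (A.prod B)) where
  subsingleton_rel : Subsingleton R.Arel
  subsingleton_abs : Subsingleton R.Aabs
  eA : R.A ≃ (ι → A)
  eB : R.B ≃ (ι → B)
  out : ∀ z z', R.N.toLin 1 z z'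
    = ∏ i, (ρ i).mat (eA z.1 i, eB z.2 i) (eA z'.1 i, eB z'.2 i)

theorem Presents.out_eq {R : FiniteResource} {ρ : ι → State (A.prod B)} (P : Presents R ρ) :
    ((Channel.relabel (Y := Sys.pi fun _ => A) P.eA).prod
      (Channel.relabel (Y := Sys.pi fun _ => B) P.eB)).toLin (R.N.toLin 1) = prodOp ρ := by
  rw [Channel.prod_relabel]
  ext z z'
  rw [Channel.relabel_toLin, Matrix.submatrix_apply, P.out]
  simp [prodOp]

/-- A static resource is a product with one factor. -/
def Presents.static (ρ : State (A.prod B)) :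
    Presents (FiniteResource.static ρ) (fun _ : Unit => ρ) where
  subsingleton_rel := inferInstanceAs (Subsingleton Unit)
  subsingleton_abs := inferInstanceAs (Subsingleton Unit)
  eA := (Equiv.funUnique Unit A).symm
  eB := (Equiv.funUnique Unit B).symm
  out z z' := by
    change ((1 : Op (Sys.null.prod Sys.null)) ((), ()) ((), ()) • ρ.mat) z z' = _
    simp

/-- A tensor product of products is a product. -/
def Presents.tensor {μ : ι → Type} [∀ i, Fintype (μ i)] [∀ i, DecidableEq (μ i)]
    {R : ι → FiniteResource} {ρ : ∀ i, μ i → State (A.prod B)} (P : ∀ i, Presents (R i) (ρ i)) :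
    Presents (FiniteResource.tensor R) (fun j : Σ i, μ i => ρ j.1 j.2) where
  subsingleton_rel :=
    have := fun i => (P i).subsingleton_rel
    inferInstanceAs (Subsingleton (∀ i, (R i).Arel))
  subsingleton_abs :=
    have := fun i => (P i).subsingleton_abs
    inferInstanceAs (Subsingleton (∀ i, (R i).Aabs))
  eA := (Equiv.piCongrRight fun i => (P i).eA).trans (Equiv.piCurry fun _ _ => A).symm
  eB := (Equiv.piCongrRight fun i => (P i).eB).trans (Equiv.piCurry fun _ _ => B).symm
  out z z' := by
    have h1 := fun i => (P i).subsingleton_rel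
    have h2 := fun i => (P i).subsingleton_abs
    have h3 : ∀ i, Subsingleton ((R i).Arel × (R i).Aabs) := fun i => inferInstance
    have hs : Subsingleton (∀ i, (R i).Arel × (R i).Aabs) := inferInstance
    dsimp only
    rw [Channel.comp_toLin, Channel.comp_toLin, relabel_one,
      Channel.relabel_toLin, Matrix.submatrix_apply, Fintype.prod_sigma]
    obtain ⟨d⟩ : Nonempty (∀ i, (R i).Arel × (R i).Aabs) := inferInstance
    change ∑ x : ∀ i, (R i).Arel × (R i).Aabs, ∑ x' : ∀ i, (R i).Arel × (R i).Aabs, _ = _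
    -- The joint input is a single point, so the double sum over matrix entries has one term.
    rw [Fintype.sum_subsingleton _ d, Fintype.sum_subsingleton _ d]
    rw [Matrix.one_apply_eq, one_mul]
    refine Finset.prod_congr rfl fun i _ => ?_
    have h4 : (Matrix.single (d i) (d i) 1 : Op (R i).input) = 1 := by
      have := h3 i
      ext a b
      rw [Subsingleton.elim a (d i), Subsingleton.elim b (d i)]
      simp
    rw [h4, (P i).out]
    rfl

variable {η : Type} [Fintype η] [DecidableEq η]

/-- The local operation that keeps the factors in `κ` and discards those in `η`. -/
def pick {Y : Sys} (g : κ ⊕ η ≃ ι) (e : Y ≃ (κ → A)) : Channel (Sys.pi fun _ : ι => A) Y :=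
  Channel.ptrace (E := Sys.pi fun _ : η => A) <|
    (Equiv.arrowCongr g.symm (Equiv.refl A)).trans <|
      (Equiv.sumArrowEquivProdArrow κ η A).trans <| Equiv.prodCongr e.symm (Equiv.refl _)

-- Discarding a factor multiplies the result by its trace, which is one, so only the kept factors
-- remain.
omit [DecidableEq κ] in
theorem pick_prod_toLin {Y Z : Sys} (g : κ ⊕ η ≃ ι) (eA : Y ≃ (κ → A)) (eB : Z ≃ (κ → B))
    (ρ : ι → State (A.prod B)) (y y' : Y.prod Z) :
    ((pick g eA).prod (pick g eB)).toLin (prodOp ρ) y y'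
      = ∏ j, (ρ (g (.inl j))).mat (eA y.1 j, eB y.2 j) (eA y'.1 j, eB y'.2 j) := by
  rw [pick, pick, Channel.ptrace_prod_apply]
  simp only [prodOp, Matrix.of_apply]
  simp_rw [fun f : ι → ℂ => (Fintype.prod_equiv g (fun i => f (g i)) f fun _ => rfl).symm,
    Fintype.prod_sum_type]
  simp only [Equiv.symm_trans_apply, Equiv.prodCongr_symm, Equiv.prodCongr_apply, Prod.map,
    Equiv.symm_symm, Equiv.refl_symm, Equiv.refl_apply, Equiv.arrowCongr_symm,
    Equiv.arrowCongr_apply, Function.comp_apply, Equiv.symm_apply_apply,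
    Equiv.sumArrowEquivProdArrow_symm_apply_inl, Equiv.sumArrowEquivProdArrow_symm_apply_inr]
  rw [← Finset.mul_sum]
  conv_rhs => rw [← mul_one (∏ j, _)]
  congr 1
  change ∑ w : (η → A) × (η → B), _ = _
  -- Pairs of tuples become tuples of pairs, so that the sum is the expansion of the product of the
  -- traces in `h`.
  rw [← (Equiv.arrowProdEquivProdArrow η (fun _ => A) (fun _ => B)).sum_comp]
  have h : ∏ i : η, (ρ (g (.inr i))).mat.trace = 1 :=
    Finset.prod_eq_one fun i _ => (ρ _).trace_eq_one
  simp only [Matrix.trace] at h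
  rw [Finset.prod_univ_sum, Fintype.piFinset_univ] at h
  exact h

omit [DecidableEq κ] in
/-- A product reduces to each of its subproducts. -/
theorem Presents.reduces {R R' : FiniteResource} {ρ : ι → State (A.prod B)}
    {ρ' : κ → State (A.prod B)} (P : Presents R ρ) (P' : Presents R' ρ') (g : κ ⊕ η ≃ ι)
    (hg : ∀ j, ρ (g (.inl j)) = ρ' j) : R.Reduces R' := by
  have := P.subsingleton_rel
  have := P.subsingleton_abs
  have := P'.subsingleton_rel
  have := P'.subsingleton_abs
  have : Subsingleton R'.input := inferInstanceAs (Subsingleton (R'.Arel × R'.Aabs))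
  have : Subsingleton R.input := inferInstanceAs (Subsingleton (R.Arel × R.Aabs))
  obtain ⟨a⟩ := R.input.ne
  obtain ⟨a'⟩ := R'.input.ne
  let e : R'.input ≃ R.input := ⟨fun _ => a, fun _ => a', fun _ => Subsingleton.elim _ _,
    fun _ => Subsingleton.elim _ _⟩
  refine ⟨Channel.relabel e, (pick g P'.eA).comp (Channel.relabel P.eA),
    (pick g P'.eB).comp (Channel.relabel P.eB), fun _ _ => Subsingleton.elim _ _, ?_⟩
  refine Channel.ext_one ?_
  rw [Channel.comp_toLin, Channel.comp_toLin, relabel_one, Channel.prod_comp, Channel.comp_toLin,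
    P.out_eq]
  ext y y'
  rw [pick_prod_toLin, P'.out]
  simp only [hg]

end Families

/-! ### Asymptotic resources from static resources -/

/-- Completes a choice of factors to keep by the factors to discard, in the form that `pick` takes.
-/
theorem exists_sum_equiv {ι κ : Type} {f : κ → ι} (hf : Function.Injective f) :
    ∃ g : κ ⊕ {i // ¬ i ∈ Set.range f} ≃ ι, ∀ j, g (.inl j) = f j := by
  classical
  exact ⟨((Equiv.ofInjective f hf).sumCongr (Equiv.refl _)).trans
    (Equiv.sumCompl fun i => i ∈ Set.range f), fun _ => rfl⟩

/-- A power of a bipartite state reduces to every smaller power. -/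
theorem Presents.reduces_of_card_le {ι κ : Type} [Fintype ι] [DecidableEq ι] [Fintype κ]
    [DecidableEq κ] {A B : Sys} {R R' : FiniteResource} {σ : State (A.prod B)}
    (P : Presents R fun _ : ι => σ) (P' : Presents R' fun _ : κ => σ)
    (h : Fintype.card κ ≤ Fintype.card ι) : R.Reduces R' := by
  classical
  obtain ⟨f⟩ := Function.Embedding.nonempty_of_card_le h
  obtain ⟨g, -⟩ := exists_sum_equiv f.injective
  exact P.reduces P' g fun _ => rfl

/-- The tensor power of a static resource. -/
def Presents.tensorPow {A B : Sys} (σ : State (A.prod B)) (n : ℕ) :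
    Presents ((FiniteResource.static σ).tensorPow n) (fun _ : Σ _ : Fin n, Unit => σ) :=
  Presents.tensor fun _ => Presents.static σ

/-- All resources involved are powers of the same state, and the `k`-fold power at index `n / k` has
`k * s (n / k)` copies. By `Presents.reduces_of_card_le`, comparing numbers of copies is enough. -/
theorem ResourceSeq.isAsymptotic_tensorPow {A B : Sys} (σ : State (A.prod B)) (s : ℕ → ℕ)
    (h₁ : ∀ n, s (n - 1) ≤ s n)
    (h₂ : ∀ δ : ℝ, 0 < δ → ∀ k : ℕ, 0 < k → ∀ᶠ n : ℕ in Filter.atTop,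
      k * s (n / k) ≤ s ⌊n * (1 + δ)⌋₊ ∧ s ⌊n * (1 - δ)⌋₊ ≤ k * s (n / k)) :
    ResourceSeq.IsAsymptotic ⟨Unit, fun n _ => (FiniteResource.static σ).tensorPow (s n)⟩ where
  monotone := Filter.Eventually.of_forall fun n => ⟨_root_.id, Function.injective_id, fun _ =>
    (Presents.tensorPow σ _).reduces_of_card_le (Presents.tensorPow σ _) (by simpa using h₁ n)⟩
  quasi_iid δ hδ k hk := (h₂ δ hδ k hk).mono fun n hn =>
    have P : Presents (((FiniteResource.static σ).tensorPow (s (n / k))).tensorPow k)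
        (fun _ : Σ _ : Fin k, Σ _ : Fin (s (n / k)), Unit => σ) :=
      Presents.tensor fun _ => Presents.tensorPow σ _
    ⟨⟨_root_.id, Function.injective_id, fun _ =>
      (Presents.tensorPow σ _).reduces_of_card_le P (by simpa using hn.1)⟩,
    ⟨_root_.id, Function.injective_id, fun _ =>
      P.reduces_of_card_le (Presents.tensorPow σ _) (by simpa using hn.2)⟩⟩

/-- Rounding on the left only helps: `k * ⌊z * (n / k)⌋ ≤ z * n`. Since `n ≤ ⌊n * (1 + δ)⌋`, no
largeness of `n` is needed. -/
theorem mul_floor_div_le (z δ : ℝ) (hz : 0 ≤ z) (hδ : 0 ≤ δ) (k n : ℕ) :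
    k * ⌊z * (n / k : ℕ)⌋₊ ≤ ⌊z * ⌊n * (1 + δ)⌋₊⌋₊ := by
  refine Nat.le_floor ?_
  push_cast
  have h1 : (⌊z * (n / k : ℕ)⌋₊ : ℝ) ≤ z * (n / k : ℕ) := Nat.floor_le (by positivity)
  have h2 : ((k * (n / k) : ℕ) : ℝ) ≤ n := by exact_mod_cast Nat.mul_div_le n k
  have h3 : (n : ℝ) ≤ ⌊n * (1 + δ)⌋₊ := by
    exact_mod_cast Nat.le_floor (by nlinarith [Nat.cast_nonneg (α := ℝ) n])
  push_cast at h2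
  calc (k : ℝ) * ⌊z * (n / k : ℕ)⌋₊ ≤ k * (z * (n / k : ℕ)) := by gcongr
    _ = z * (k * (n / k : ℕ)) := by ring
    _ ≤ z * ⌊n * (1 + δ)⌋₊ := by gcongr; exact h2.trans h3

/-- The two roundings on the right lose at most `z * k + k` against `z * n`, while the left side is
smaller than `z * n` by at least `z * δ * n` if `δ < 1`. This explains the threshold for `n`. -/
theorem eventually_floor_le_mul_floor_div (z δ : ℝ) (hz : 0 ≤ z) (hδ : 0 < δ) (k : ℕ)
    (hk : 0 < k) :
    ∀ᶠ n : ℕ in Filter.atTop, ⌊z * ⌊n * (1 - δ)⌋₊⌋₊ ≤ k * ⌊z * (n / k : ℕ)⌋₊ := by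
  rcases hz.eq_or_lt with rfl | hz
  · simp
  filter_upwards [Filter.eventually_ge_atTop ⌈(z * k + k) / (z * δ)⌉₊] with n hn
  have hn' := Nat.ceil_le.1 hn
  rw [div_le_iff₀ (by positivity)] at hn'
  -- For `δ ≥ 1` the index is rounded to zero, and the left side vanishes.
  rcases le_or_gt 1 δ with h1 | h1
  · rw [Nat.floor_of_nonpos (mul_nonpos_of_nonneg_of_nonpos (Nat.cast_nonneg n) (by linarith))]
    simp
  have h2 : (⌊n * (1 - δ)⌋₊ : ℝ) ≤ n * (1 - δ) :=
    Nat.floor_le (mul_nonneg (Nat.cast_nonneg n) (by linarith))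
  have h3 : (⌊z * ⌊n * (1 - δ)⌋₊⌋₊ : ℝ) ≤ z * ⌊n * (1 - δ)⌋₊ := Nat.floor_le (by positivity)
  have h4 : (n : ℝ) ≤ k * (n / k : ℕ) + k := by
    have := (Nat.lt_mul_div_succ n hk).le
    rw [mul_add, mul_one] at this
    exact_mod_cast this
  have h5 : z * (n / k : ℕ) ≤ ⌊z * (n / k : ℕ)⌋₊ + 1 := (Nat.lt_floor_add_one _).le
  have hk' : (0 : ℝ) < k := by exact_mod_cast hk
  rw [← Nat.cast_le (α := ℝ)]
  push_cast only [Nat.cast_mul]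
  nlinarith [mul_le_mul_of_nonneg_left h5 hk'.le, mul_le_mul_of_nonneg_left h4 hz.le,
    mul_le_mul_of_nonneg_left h2 hz.le]

theorem ResourceSeq.isAsymptotic_smul_iid_static {A B : Sys} (σ : State (A.prod B)) (z : ℝ)
    (hz : 0 ≤ z) : (ResourceSeq.smul z (.iid (.static σ))).IsAsymptotic :=
  isAsymptotic_tensorPow σ (fun n => ⌊z * n⌋₊)
    (fun n => Nat.floor_mono (by gcongr; exact Nat.sub_le n 1))
    fun δ hδ k hk => (eventually_floor_le_mul_floor_div z δ hz hδ k hk).mono fun n hn =>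
      ⟨mul_floor_div_le z δ hz hδ.le k n, hn⟩

theorem ResourceSeq.isAsymptotic_iid_static {A B : Sys} (σ : State (A.prod B)) :
    (ResourceSeq.iid (.static σ)).IsAsymptotic := by
  refine isAsymptotic_tensorPow σ (fun n => n) (fun n => Nat.sub_le n 1) fun δ hδ k hk => ?_
  have h := eventually_floor_le_mul_floor_div 1 δ zero_le_one hδ k hk
  have h' := mul_floor_div_le 1 δ zero_le_one hδ.le k
  simp only [one_mul, Nat.floor_natCast] at h h'
  exact h.mono fun n hn => ⟨h' n, hn⟩

theorem ResourceSeq.IsAsymptotic.sum {κ : Type} [Fintype κ] [DecidableEq κ] {α : κ → ResourceSeq}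
    (h : ∀ x, (α x).IsAsymptotic) : (ResourceSeq.sum α).IsAsymptotic := by
  constructor
  · filter_upwards [Filter.eventually_all.2 fun x => (h x).monotone] with n hn
    choose f hf hr using hn
    exact ⟨Sigma.map _root_.id f, Function.injective_id.sigma_map hf, fun i => hr i.1 i.2⟩
  · intro δ hδ k hk
    filter_upwards [Filter.eventually_all.2 fun x => (h x).quasi_iid δ hδ k hk] with n hn
    choose f hf hr using fun x => (hn x).1
    choose f' hf' hr' using fun x => (hn x).2
    exact ⟨⟨Sigma.map _root_.id f, Function.injective_id.sigma_map hf, fun i => hr i.1 i.2⟩,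
      ⟨Sigma.map _root_.id f', Function.injective_id.sigma_map hf', fun i => hr' i.1 i.2⟩⟩

/-! ### Protocols with one round -/

theorem Channel.relabel_prod_id_apply {X Y Z : Sys} (e : X ≃ Y) (M : Op (X.prod Z))
    (y y' : Y.prod Z) :
    ((Channel.relabel e).prod (Channel.id Z)).toLin M y y'
      = M (e.symm y.1, y.2) (e.symm y'.1, y'.2) := by
  rw [Channel.id, Channel.prod_relabel]
  rfl

/-- A single round, in which Alice's laboratory is the input of the component. -/
def Rounds.single {ι : Type} (R : ι → FiniteResource) (i : ι) :
    Rounds R ((R i).input.prod Sys.null) [i] ((R i).A.prod Sys.null) :=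
  .round 1 (by simp) (.done _)

/-- The isometry is the identity and the memory is null, so the run is the component itself padded
with one-dimensional factors. -/
theorem Rounds.single_run_toLin {ι : Type} (R : ι → FiniteResource) (i : ι)
    (T : Op (R i).input) :
    (Rounds.single R i).run.toLin ((Channel.relabel (Y := (R i).input.prod Sys.null)
      (Equiv.prodUnique (R i).input Unit).symm).toLin T)
      = (Matrix.of fun z z' => (R i).N.toLin T (z.1.1, z.2.1) (z'.1.1, z'.2.1) :
        Op (((R i).A.prod Sys.null).prod ((R i).B.prod Sys.null))) := by
  have hT : (Channel.relabel (Y := (R i).input.prod Sys.null)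
      (Equiv.prodUnique (R i).input Unit).symm).toLin T
      = (kron T 1 : Op ((R i).input.prod Sys.null)) := by
    ext z z'
    rw [kron_apply, Subsingleton.elim z'.2 z.2, Matrix.one_apply_eq, mul_one]
    rfl
  have hV : ∀ M : Op ((R i).input.prod Sys.null),
      (Channel.ofIsometry (1 : Op ((R i).input.prod Sys.null)) (by simp)).toLin M = M := by
    intro M
    change 1 * M * Matrix.conjTranspose 1 = M
    simp
  have hN : ((R i).N.prod (Channel.id Sys.null)).toLin ((Channel.ofIsometry
      (1 : Op ((R i).input.prod Sys.null)) (by simp)).toLin (kron T 1))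
      = kron ((R i).N.toLin T) 1 := by
    rw [hV, Channel.prod_kron, Channel.id_toLin]
  rw [hT]
  ext z z'
  refine (Channel.relabel_prod_id_apply (X := (R i).A.prod Sys.null)
    (Y := ((R i).A.prod Sys.null).prod (bobSys R []))
    (Equiv.prodUnique ((R i).A.prod Sys.null) Unit).symm _ ((z.1, z.2.2), z.2.1)
    ((z'.1, z'.2.2), z'.2.1)).trans ?_
  refine (congrFun (congrFun hN _) _).trans ?_
  change (R i).N.toLin T (z.1.1, z.2.1) (z'.1.1, z'.2.1) * (1 : Op Sys.null) () () = _
  rw [Matrix.one_apply_eq, mul_one]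
  rfl

/-- The protocol that uses the only component of a resource once, with given local operations. -/
def Protocol.single {R : Resource} {Arel Aabs A B : Sys} (i : R.ι) (hi : ∀ j, j = i)
    (E : Channel (Arel.prod Aabs) (R.comp i).input) (DA : Channel (R.comp i).A A)
    (DB : Channel (R.comp i).B B) : Protocol R Arel Aabs A B where
  order := [i]
  nodup := List.nodup_singleton i
  complete j := by rw [hi j]; exact List.mem_singleton_self i
  start := (R.comp i).input.prod Sys.null
  finish := (R.comp i).A.prod Sys.null
  enc := (Channel.relabel (Y := (R.comp i).input.prod Sys.null)
    (Equiv.prodUnique (R.comp i).input Unit).symm).comp E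
  rounds := Rounds.single R.comp i
  final := DA.comp (Channel.relabel (X := (R.comp i).A.prod Sys.null)
    (Equiv.prodUnique (R.comp i).A Unit))
  dec := DB.comp (Channel.relabel (X := (R.comp i).B.prod Sys.null)
    (Equiv.prodUnique (R.comp i).B Unit))

theorem Protocol.single_map {R : Resource} {Arel Aabs A B : Sys} (i : R.ι) (hi : ∀ j, j = i)
    (E : Channel (Arel.prod Aabs) (R.comp i).input) (DA : Channel (R.comp i).A A)
    (DB : Channel (R.comp i).B B) :
    (Protocol.single i hi E DA DB).map = (DA.prod DB).comp ((R.comp i).N.comp E) := by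
  refine Channel.ext (LinearMap.ext fun S => ?_)
  change ((DA.comp (Channel.relabel (X := (R.comp i).A.prod Sys.null)
    (Equiv.prodUnique (R.comp i).A Unit))).prod
      (DB.comp (Channel.relabel (X := (R.comp i).B.prod Sys.null)
        (Equiv.prodUnique (R.comp i).B Unit)))).toLin
    ((Rounds.single R.comp i).run.toLin ((Channel.relabel (Y := (R.comp i).input.prod Sys.null)
      (Equiv.prodUnique (R.comp i).input Unit).symm).toLin (E.toLin S))) = _
  rw [Rounds.single_run_toLin, Channel.prod_comp, Channel.comp_toLin, Channel.prod_relabel]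
  rfl

/-- A one-dimensional test system has only one state, so the deviation is zero. -/
theorem Protocol.single_valid {R : Resource} {Arel Aabs A B : Sys} (i : R.ι) (hi : ∀ j, j = i)
    (E : Channel (Arel.prod Aabs) (R.comp i).input) (DA : Channel (R.comp i).A A)
    (DB : Channel (R.comp i).B B) [Subsingleton (R.comp i).Arel] (Ω : State Arel) {ε : ℝ}
    (hε : 0 ≤ ε) : (Protocol.single i hi E DA DB).Valid ε Ω := by
  intro Q ξ _
  refine ⟨?_, trivial⟩
  refine le_of_eq_of_le ?_ hε
  rw [← traceNorm_zero]
  refine congrArg traceNorm (sub_eq_zero.2 (congrArg State.mat (Subsingleton.elim _ _)))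

/-! ### Extraction of the conditional states from a labelled ensemble -/

section Extraction

variable {X A B : Sys} {p : X → ℝ} (hp : ∀ x, 0 ≤ p x) (hp1 : ∑ x, p x = 1)
  (ρ : X → State (A.prod B))

/-- Entries diagonal in both labels suffice, since the labels will be measured. The condition `x =
y` is the perfect correlation of the two copies. -/
theorem labelled_apply (a a' : A) (b b' : B) (x y : X) :
    (labelled p hp hp1 ρ).mat ((a, x), (b, y)) ((a', x), (b', y))
      = if x = y then (p x : ℂ) * (ρ x).mat (a, b) (a', b') else 0 := by
  change (∑ w, (p w : ℂ) • (Matrix.kronecker (Matrix.kronecker (Matrix.single w w (1 : ℂ))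
    (Matrix.single w w (1 : ℂ))) (ρ w).mat).submatrix
      (fun z : (A × X) × (B × X) => ((z.1.2, z.2.2), (z.1.1, z.2.1)))
      (fun z : (A × X) × (B × X) => ((z.1.2, z.2.2), (z.1.1, z.2.1))))
      ((a, x), (b, y)) ((a', x), (b', y)) = _
  rw [Matrix.sum_apply, Finset.sum_eq_single x]
  · by_cases h : x = y <;> simp [Matrix.kronecker, h]
  · intro w _ hw
    simp [Matrix.kronecker, hw]
  · simp

variable {ι κ : Type} [Fintype ι] [DecidableEq ι] [Fintype κ] [DecidableEq κ]

/-- The product of a family of bipartite states, as a state. -/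
def prodState (τ : ι → State (A.prod B)) :
    State ((Sys.pi fun _ : ι => A).prod (Sys.pi fun _ : ι => B)) :=
  (Channel.relabel (Equiv.arrowProdEquivProdArrow ι (fun _ => A) fun _ => B)).onState (State.pi τ)

/-- Separating the labels from the states. -/
def unzip (ι : Type) [Fintype ι] [DecidableEq ι] (A X : Sys) : Channel (Sys.pi fun _ : ι => A.prod X)
    ((Sys.pi fun _ : ι => A).prod (Sys.pi fun _ : ι => X)) :=
  Channel.relabel (Equiv.arrowProdEquivProdArrow ι (fun _ => A) fun _ => X)

/-- Label sequences that differ at one position have a vanishing factor there. Equal ones collect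
the probabilities and the conditional states. -/
theorem block_unzip_labelled (c c' : ι → X) :
    Channel.block (C₁ := Sys.pi fun _ : ι => X) (C₂ := Sys.pi fun _ : ι => X)
      (((unzip ι A X).prod (unzip ι B X)).toLin (prodOp fun _ => labelled p hp hp1 ρ)) c c'
      = if c = c' then ((∏ i, p (c i) : ℝ) : ℂ) • prodOp (fun i => ρ (c i)) else 0 := by
  rw [unzip, unzip, Channel.prod_relabel]
  ext z z'
  change ∏ i, (labelled p hp hp1 ρ).mat ((z.1 i, c i), (z.2 i, c' i))
    ((z'.1 i, c i), (z'.2 i, c' i)) = _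
  refine (Finset.prod_congr rfl fun i _ =>
    labelled_apply hp hp1 ρ (z.1 i) (z'.1 i) (z.2 i) (z'.2 i) (c i) (c' i)).trans ?_
  split_ifs with h
  · subst h
    simp only [if_true, Finset.prod_mul_distrib, Complex.ofReal_prod]
    rfl
  · obtain ⟨i, hi⟩ := Function.ne_iff.1 h
    exact Finset.prod_eq_zero (Finset.mem_univ i) (if_neg hi)

/-- Both parties keep the positions given by the same injection, which they compute from `c` alone.
The existence of `f` is a premise inside the statement, so that decoders are available for every `c`
and can be controlled by the label. -/
theorem exists_extraction {R' : FiniteResource} {l : κ → X}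
    (P' : Presents R' fun j => ρ (l j)) (c : ι → X) :
    ∃ (DA : Channel (Sys.pi fun _ : ι => A) R'.A) (DB : Channel (Sys.pi fun _ : ι => B) R'.B),
      (∃ f : κ → ι, Function.Injective f ∧ ∀ j, c (f j) = l j) →
        (DA.prod DB).toLin (prodOp fun i => ρ (c i)) = R'.N.toLin 1 := by
  classical
  by_cases h : ∃ f : κ → ι, Function.Injective f ∧ ∀ j, c (f j) = l j
  · obtain ⟨f, hf, hl⟩ := h
    obtain ⟨g, hg⟩ := exists_sum_equiv hf
    refine ⟨pick g P'.eA, pick g P'.eB, fun _ => ?_⟩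
    ext y y'
    rw [pick_prod_toLin, P'.out]
    simp only [hg, hl]
  · exact ⟨Channel.reset (Classical.arbitrary _), Channel.reset (Classical.arbitrary _),
      fun h' => absurd h' h⟩

open Classical in
/-- From a power of the labelled ensemble, Alice and Bob obtain a product of conditional states, up
to the probability that the labels needed are not available. -/
theorem exists_protocol {R : Resource} (i : R.ι) (hi : ∀ j, j = i) {R' : FiniteResource}
    {l : κ → X} (P : Presents (R.comp i) fun _ : ι => labelled p hp hp1 ρ)
    (P' : Presents R' fun j => ρ (l j)) {ε : ℝ} (hε : 0 ≤ ε)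
    (hbad : ∑ c : ι → X with ¬ ∃ f : κ → ι, Function.Injective f ∧ ∀ j, c (f j) = l j,
      ∏ i, p (c i) ≤ ε / 2) :
    ∃ Q : Protocol R R'.Arel R'.Aabs R'.A R'.B, Q.Valid ε R'.ω ∧
      (Q.create R'.ω).N.dist R'.N R'.ω ≤ ENNReal.ofReal ε := by
  have := P.subsingleton_rel
  have := P.subsingleton_abs
  have := P'.subsingleton_rel
  have := P'.subsingleton_abs
  have hs' : Subsingleton R'.input := inferInstanceAs (Subsingleton (R'.Arel × R'.Aabs))
  have : Subsingleton (R.comp i).input :=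
    inferInstanceAs (Subsingleton ((R.comp i).Arel × (R.comp i).Aabs))
  obtain ⟨a⟩ := (R.comp i).input.ne
  obtain ⟨a'⟩ := R'.input.ne
  let e : R'.input ≃ (R.comp i).input := ⟨fun _ => a, fun _ => a', fun _ => Subsingleton.elim _ _,
    fun _ => Subsingleton.elim _ _⟩
  choose DA DB hD using exists_extraction (ι := ι) ρ P'
  refine ⟨Protocol.single i hi (Channel.relabel e)
    ((Channel.control (C := Sys.pi fun _ : ι => X) DA).comp
      ((unzip ι A X).comp (Channel.relabel P.eA)))
    ((Channel.control (C := Sys.pi fun _ : ι => X) DB).comp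
      ((unzip ι B X).comp (Channel.relabel P.eB))), Protocol.single_valid _ _ _ _ _ _ hε, ?_⟩
  -- `T` is the target state and `S c` is what the parties produce from the label sequence `c`.
  let T : State (R'.A.prod R'.B) := R'.N.onState ⟨1, Matrix.PosSemidef.one, by
    rw [Matrix.trace, Fintype.sum_subsingleton _ a', Matrix.diag_apply, Matrix.one_apply_eq]⟩
  let S : (ι → X) → State (R'.A.prod R'.B) := fun c =>
    ((DA c).prod (DB c)).onState (prodState fun i => ρ (c i))
  let bad : Finset (ι → X) :=
    {c | ¬ ∃ f : κ → ι, Function.Injective f ∧ ∀ j, c (f j) = l j}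
  have hpos : ∀ c : ι → X, (0 : ℂ) ≤ ((∏ i, p (c i) : ℝ) : ℂ) := fun c => by
    exact_mod_cast Finset.prod_nonneg fun i _ => hp (c i)
  have hsum : ∑ c : ι → X, ((∏ i, p (c i) : ℝ) : ℂ) = 1 := by
    rw [← Complex.ofReal_sum, ← Fintype.piFinset_univ, ← Finset.prod_univ_sum]
    simp [hp1]
  -- Actual output and target are both written as averages over `c`. Good sequences cancel, and the
  -- two bad parts have trace at most `ε / 2` each.
  refine Channel.dist_le _ _ _
    (P := ∑ c ∈ bad, ((∏ i, p (c i) : ℝ) : ℂ) • (S c).mat)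
    (P' := ∑ c ∈ bad, ((∏ i, p (c i) : ℝ) : ℂ) • T.mat)
    (Matrix.posSemidef_sum _ fun c _ => (S c).posSemidef.smul (hpos c))
    (Matrix.posSemidef_sum _ fun c _ => T.posSemidef.smul (hpos c)) ?_ ?_
  · have hout : (Protocol.single i hi (Channel.relabel e)
        ((Channel.control (C := Sys.pi fun _ : ι => X) DA).comp
          ((unzip ι A X).comp (Channel.relabel P.eA)))
        ((Channel.control (C := Sys.pi fun _ : ι => X) DB).comp
          ((unzip ι B X).comp (Channel.relabel P.eB)))).map.toLin 1
        = ∑ c : ι → X, ((∏ i, p (c i) : ℝ) : ℂ) • (S c).mat := by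
      rw [Protocol.single_map, Channel.comp_toLin, Channel.comp_toLin, relabel_one,
        Channel.prod_comp, Channel.prod_comp, Channel.comp_toLin, Channel.comp_toLin, P.out_eq,
        Channel.control_prod_toLin]
      change ∑ c : ι → X, ∑ c' : ι → X, _ = _
      refine Finset.sum_congr rfl fun c _ => ?_
      rw [Finset.sum_eq_single c]
      · rw [block_unzip_labelled, if_pos rfl, map_smul]
        rfl
      · intro c' _ hc
        rw [block_unzip_labelled, if_neg hc.symm, map_zero]
      · simp
    have hT : R'.N.toLin 1 = ∑ c : ι → X, ((∏ i, p (c i) : ℝ) : ℂ) • T.mat := by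
      rw [← Finset.sum_smul, hsum, one_smul]
      rfl
    rw [hout, hT, ← Finset.sum_sub_distrib, ← Finset.sum_sub_distrib]
    refine (Finset.sum_subset (Finset.subset_univ _) fun c _ hc => ?_).symm
    have hc' : ∃ f : κ → ι, Function.Injective f ∧ ∀ j, c (f j) = l j := by
      by_contra h
      exact hc (Finset.mem_filter.2 ⟨Finset.mem_univ _, h⟩)
    have : (S c).mat = T.mat := hD c hc'
    rw [this, sub_self]
  · have htr : ∀ τ : (ι → X) → State (R'.A.prod R'.B),
        (∑ c ∈ bad, ((∏ i, p (c i) : ℝ) : ℂ) • (τ c).mat).trace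
          = ((∑ c ∈ bad, ∏ i, p (c i) : ℝ) : ℂ) := fun τ => by
      rw [Matrix.trace_sum, Complex.ofReal_sum]
      refine Finset.sum_congr rfl fun c _ => ?_
      rw [Matrix.trace_smul, (τ c).trace_eq_one, smul_eq_mul, mul_one]
    rw [htr S, htr fun _ => T, ← Complex.ofReal_add, Complex.ofReal_re]
    change ∑ c ∈ bad, ∏ i, p (c i) ≤ ε / 2 at hbad
    linarith

end Extraction

/-! ### Probability of unbalanced label sequences -/

section Chernoff

variable {X ι : Type} [Fintype X] [DecidableEq X] [Fintype ι] [DecidableEq ι] {p : X → ℝ}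

open Classical in
/-- A Chernoff bound for the frequency of a letter. -/
theorem sum_prod_filter_card_lt_le (hp : ∀ x, 0 ≤ p x) (hp1 : ∑ x, p x = 1) (x : X) (m : ℕ)
    {δ : ℝ} (hδ : 0 < δ) (hδ1 : δ ≤ 1) (hm : (m : ℝ) ≤ p x * (1 - δ) * Fintype.card ι) :
    ∑ c : ι → X with Fintype.card {i // c i = x} < m, ∏ i, p (c i)
      ≤ Real.exp (-(δ ^ 2 * p x / 4) * Fintype.card ι) := by
  set n := Fintype.card ι
  -- The tilting parameter satisfies `1 - δ ≤ t ^ 2`, which leaves an exponent `(1 - t) ^ 2 * p x =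
  -- δ ^ 2 * p x / 4` at the end.
  set t : ℝ := 1 - δ / 2 with ht
  have ht0 : 0 < t := by linarith
  have ht1 : t ≤ 1 := by linarith
  -- The expectation of `t` to the number of occurrences of `x` factorises by independence.
  have hmgf : ∑ c : ι → X, (∏ i, p (c i)) * t ^ Fintype.card {i // c i = x}
      = (1 - p x * (1 - t)) ^ n := by
    have h : ∀ c : ι → X, (∏ i, p (c i)) * t ^ Fintype.card {i // c i = x}
        = ∏ i, p (c i) * if c i = x then t else 1 := fun c => by
      rw [Finset.prod_mul_distrib, Finset.prod_ite, Finset.prod_const_one, mul_one,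
        Finset.prod_const, Fintype.card_subtype]
    have h1 : ∑ y, p y * (if y = x then t else 1) = 1 - p x * (1 - t) := by
      have : ∀ y, p y * (if y = x then t else 1) = p y - if y = x then p x * (1 - t) else 0 := by
        intro y
        split_ifs with hy
        · rw [hy]; ring
        · ring
      simp only [this, Finset.sum_sub_distrib, hp1, Finset.sum_ite_eq', Finset.mem_univ, if_true]
    simp_rw [h]
    rw [← Fintype.piFinset_univ, ← Finset.prod_univ_sum (fun _ => Finset.univ)
      (fun _ y => p y * if y = x then t else 1), h1, Finset.prod_const, Finset.card_univ]
  -- Markov's inequality: as `t ≤ 1`, fewer than `m` occurrences make the power of `t` at least `t ^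
  -- m`.
  have hmarkov : (∑ c : ι → X with Fintype.card {i // c i = x} < m, ∏ i, p (c i)) * t ^ m
      ≤ (1 - p x * (1 - t)) ^ n := by
    rw [← hmgf, Finset.sum_mul]
    refine (Finset.sum_le_sum fun c hc => ?_).trans
      (Finset.sum_le_sum_of_subset_of_nonneg (Finset.filter_subset _ _) fun c _ _ => ?_)
    · exact mul_le_mul_of_nonneg_left (pow_le_pow_of_le_one ht0.le ht1
        (Finset.mem_filter.1 hc).2.le) (Finset.prod_nonneg fun i _ => hp _)
    · exact mul_nonneg (Finset.prod_nonneg fun i _ => hp _) (pow_nonneg ht0.le _)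
  have hpx : p x ≤ 1 := hp1 ▸ Finset.single_le_sum (fun y _ => hp y) (Finset.mem_univ x)
  have hbase : (1 - p x * (1 - t)) ^ n ≤ Real.exp (-(p x * (1 - t)) * n) := by
    rw [mul_comm (-(p x * (1 - t))), Real.exp_nat_mul]
    refine pow_le_pow_left₀ ?_ (by linarith [Real.add_one_le_exp (-(p x * (1 - t)))]) n
    nlinarith [hp x]
  -- From `1 / t = 1 + (1 - t) / t ≤ exp ((1 - t) / t)`.
  have htm : Real.exp (-((1 - t) / t) * m) ≤ t ^ m := by
    rw [mul_comm, Real.exp_nat_mul]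
    refine pow_le_pow_left₀ (Real.exp_pos _).le ?_ m
    rw [Real.exp_neg, inv_le_comm₀ (Real.exp_pos _) ht0]
    refine le_of_eq_of_le ?_ (Real.add_one_le_exp _)
    field_simp
    ring
  have hexp : -(p x * (1 - t)) * n
      ≤ -(δ ^ 2 * p x / 4) * n + -((1 - t) / t) * m := by
    have h1 : (m : ℝ) ≤ t * (t * (p x * n)) := by
      refine hm.trans ?_
      have : 0 ≤ p x * n := mul_nonneg (hp x) (Nat.cast_nonneg n)
      rw [ht]
      nlinarith [mul_nonneg this (sq_nonneg δ)]
    have h2 : (1 - t) / t * m ≤ (1 - t) * (t * (p x * n)) := by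
      rw [div_mul_eq_mul_div, div_le_iff₀ ht0]
      nlinarith [mul_le_mul_of_nonneg_left h1 (by linarith : 0 ≤ 1 - t)]
    have h3 : 1 - t = δ / 2 := by rw [ht]; ring
    have h4 : t = 1 - δ / 2 := ht
    rw [h3] at h2 ⊢
    rw [h4] at h2 ⊢
    nlinarith
  have hS : 0 ≤ ∑ c : ι → X with Fintype.card {i // c i = x} < m, ∏ i, p (c i) :=
    Finset.sum_nonneg fun c _ => Finset.prod_nonneg fun i _ => hp _
  have h := (mul_le_mul_of_nonneg_left htm hS).trans
    (hmarkov.trans (hbase.trans (Real.exp_le_exp.2 hexp)))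
  rw [Real.exp_add] at h
  exact le_of_mul_le_mul_right h (Real.exp_pos _)

end Chernoff

/-! ### Filling the required slots, and the union bound over labels -/

open Filter Topology

/-- The slots to be filled, `s x` of them with label `x`. -/
abbrev Slots (X : Type) (s : X → ℕ) : Type := Σ i : (Σ _ : X, Unit), Σ _ : Fin (s i.1), Unit

/-- A label sequence in which every label is frequent enough can fill all slots. -/
theorem exists_fill {X ι : Type} [DecidableEq X] [Fintype ι] {s : X → ℕ} {c : ι → X}
    (h : ∀ x, s x ≤ Fintype.card {i // c i = x}) :
    ∃ f : Slots X s → ι, Function.Injective f ∧ ∀ j, c (f j) = j.1.1 := by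
  have hg : ∀ x, Nonempty (Fin (s x) ↪ {i // c i = x}) := fun x =>
    Function.Embedding.nonempty_of_card_le (by simpa using h x)
  let g := fun x => (hg x).some
  refine ⟨fun j => g j.1.1 j.2.1, ?_, fun j => (g j.1.1 j.2.1).2⟩
  rintro ⟨⟨x, ⟨⟩⟩, ⟨k, ⟨⟩⟩⟩ ⟨⟨y, ⟨⟩⟩, ⟨k', ⟨⟩⟩⟩ (hxy : (g x k : ι) = g y k')
  -- The label at the filled position determines the label of the slot, so slots with different
  -- labels never collide.
  obtain rfl : x = y := (g x k).2.symm.trans ((congrArg c hxy).trans (g y k').2)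
  obtain rfl : k = k' := (g x).injective (Subtype.ext hxy)
  rfl

/-- Labels of probability zero are excluded because their terms would be constantly one. -/
theorem tendsto_sum_exp {X : Type} [Fintype X] {p : X → ℝ} (hp : ∀ x, 0 ≤ p x) {δ : ℝ}
    (hδ : 0 < δ) :
    Tendsto (fun n : ℕ => ∑ x with p x ≠ 0, Real.exp (-(δ ^ 2 * p x / 4) * n)) atTop (𝓝 0) := by
  suffices h : Tendsto (fun n : ℕ => ∑ x with p x ≠ 0, Real.exp (-(δ ^ 2 * p x / 4) * n)) atTop
      (𝓝 (∑ x with p x ≠ 0, 0)) by rwa [Finset.sum_const_zero] at h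
  refine tendsto_finsetSum _ fun x hx => ?_
  have hx' : 0 < p x := (hp x).lt_of_ne' (Finset.mem_filter.1 hx).2
  refine Real.tendsto_exp_atBot.comp ?_
  exact tendsto_natCast_atTop_atTop.const_mul_atTop_of_neg (neg_neg_of_pos (by positivity))

open Classical in
/-- The probability that some label is too rare to fill the slots. -/
theorem sum_prod_filter_not_fill_le {X ι : Type} [Fintype X] [Fintype ι]
    {p : X → ℝ} (hp : ∀ x, 0 ≤ p x) (hp1 : ∑ x, p x = 1)
    {s : X → ℕ} {δ : ℝ} (hδ : 0 < δ) (hδ1 : δ ≤ 1)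
    (hs : ∀ x, (s x : ℝ) ≤ p x * (1 - δ) * Fintype.card ι) :
    ∑ c : ι → X with ¬ ∃ f : Slots X s → ι, Function.Injective f ∧ ∀ j, c (f j) = j.1.1,
        ∏ i, p (c i)
      ≤ ∑ x with p x ≠ 0, Real.exp (-(δ ^ 2 * p x / 4) * Fintype.card ι) := by
  refine le_trans ?_ (Finset.sum_le_sum fun x _ =>
    sum_prod_filter_card_lt_le (ι := ι) hp hp1 x (s x) hδ hδ1 (hs x))
  have hw : ∀ c : ι → X, 0 ≤ ∏ i, p (c i) := fun c => Finset.prod_nonneg fun i _ => hp _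
  -- Union bound: after exchanging the sums, each bad sequence is counted at least once among the
  -- labels that are too rare in it.
  simp_rw [Finset.sum_filter (p := fun c : ι → X => Fintype.card {i // c i = _} < s _)]
  rw [Finset.sum_comm, Finset.sum_filter]
  refine Finset.sum_le_sum fun c _ => ?_
  have h0 : ∀ x ∈ Finset.univ.filter fun x => p x ≠ 0,
      0 ≤ if Fintype.card {i // c i = x} < s x then ∏ i, p (c i) else 0 := fun x _ => by
    split_ifs
    exacts [hw c, le_rfl]
  by_cases hc : ∃ f : Slots X s → ι, Function.Injective f ∧ ∀ j, c (f j) = j.1.1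
  swap
  · rw [if_pos hc]
    obtain ⟨x, hx⟩ : ∃ x, Fintype.card {i // c i = x} < s x := by
      by_contra! h
      exact hc (exists_fill h)
    -- A label of probability zero has no slots, so it cannot be too rare.
    have hx0 : p x ≠ 0 := fun h => by
      have := hs x
      rw [h, zero_mul, zero_mul, ← Nat.cast_zero, Nat.cast_le] at this
      omega
    refine le_trans ?_ (Finset.single_le_sum h0 (Finset.mem_filter.2 ⟨Finset.mem_univ x, hx0⟩))
    rw [if_pos hx]
  · rw [if_neg (not_not.2 hc)]
    exact Finset.sum_nonneg h0

end QRI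

end

/-! ### The resource inequality -/

theorem mainTheorem12 (X A B : QRI.Sys) (p : X → ℝ) (hp : ∀ x, 0 ≤ p x) (hp1 : ∑ x, p x = 1)
    (ρ : X → QRI.State (A.prod B)) :
    let α : QRI.ResourceSeq := .iid (.static (QRI.labelled p hp hp1 ρ))
    let β : QRI.ResourceSeq := .sum fun x => .smul (p x) (.iid (.static (ρ x)))
    α.IsAsymptotic ∧ β.IsAsymptotic ∧ α.Ge β := by
  classical
  refine ⟨QRI.ResourceSeq.isAsymptotic_iid_static _, QRI.ResourceSeq.IsAsymptotic.sum fun x =>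
    QRI.ResourceSeq.isAsymptotic_smul_iid_static _ _ (hp x),
    fun δ hδ => ⟨1, one_pos, fun ε hε => ?_⟩⟩
  -- The Chernoff bound needs a parameter of at most one. For `δ ≥ 1` the target index is zero, and
  -- no slots are required.
  have hδ' : 0 < min δ 1 := lt_min hδ one_pos
  obtain ⟨n₀, hn₀⟩ := Filter.eventually_atTop.1
    ((QRI.tendsto_sum_exp hp hδ').eventually_le_const (half_pos hε))
  refine ⟨n₀, fun n hn => ?_⟩
  let s : X → ℕ := fun x => ⌊p x * ⌊(1 - δ) * n⌋₊⌋₊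
  have hcard : (Fintype.card (Σ _ : Fin (n / 1), Unit) : ℝ) = n := by simp
  refine QRI.exists_protocol (R := (QRI.ResourceSeq.nth _ (n / 1)).copies 1) hp hp1 ρ
    (l := fun j : QRI.Slots X s => j.1.1)
    ((0, ()) : Fin 1 × Unit) (fun j => Subsingleton.elim (α := Fin 1 × Unit) _ _)
    (QRI.Presents.tensorPow _ (n / 1))
    (QRI.Presents.tensor fun i : (Σ _ : X, Unit) => QRI.Presents.tensorPow (ρ i.1) (s i.1)) hε.le ?_
  have hs : ∀ x, (s x : ℝ) ≤ p x * (1 - min δ 1) * Fintype.card (Σ _ : Fin (n / 1), Unit) := by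
    intro x
    rw [hcard, mul_assoc]
    refine (Nat.floor_le (mul_nonneg (hp x) (Nat.cast_nonneg _))).trans
      (mul_le_mul_of_nonneg_left ?_ (hp x))
    rcases le_total δ 1 with h | h
    · rw [min_eq_left h]
      exact Nat.floor_le (mul_nonneg (by linarith) (Nat.cast_nonneg n))
    · rw [min_eq_right h, Nat.floor_of_nonpos
        (mul_nonpos_of_nonpos_of_nonneg (by linarith) (Nat.cast_nonneg n))]
      simp
  have h := QRI.sum_prod_filter_not_fill_le hp hp1 hδ' (min_le_right _ _) hs
  rw [hcard] at h
  -- The two sums differ only in their decidability instances.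
  exact le_of_eq_of_le (by congr!) (h.trans (hn₀ n hn))
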